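/- **Conventions.** Algebras are complex, associative, not necessarily unital; $\sqcup$ is their free product (coproduct). Fix a two-element set of faces $\mathcal F=\{\circ,\bullet\}$. A *two-faced algebra* is an algebra $A$ freely generated by given subalgebras $A^{\circ},A^{\bullet}$, i.e. $A=A^\circ\sqcup A^\bullet$; a two-faced homomorphism maps faces into the corresponding faces, and $(A\sqcup B)^q:=A^q\sqcup B^q$ for $q\in\mathcal F$. A *universal product* $\odot$ assigns to linear functionals $\varphi_1,\varphi_2$ on two-faced algebras $A_1,A_2$ a linear functional $\varphi_1\odot\varphi_2$ on $A_1\sqcup A_2$ such that (up to the canonical identifications of free products) $(\varphi_1\circ h_1)\odot(\varphi_2\circ h_2)=(\varphi_1\odot\varphi_2)\circ(h_1\sqcup h_2)$ for all two-faced homomorphisms $h_i$, $(\varphi_1\odot\varphi_2)\odot\varphi_3=\varphi_1\odot(\varphi_2\odot\varphi_3)$, and $(\varphi_1\odot\varphi_2)|_{A_i}=\varphi_i$. It is *symmetric* if $\varphi_1\odot\varphi_2=\varphi_2\odot\varphi_1$. For $\mathbf f\in\mathcal F^n$ let $\mathcal P(\mathbf f)$ be the set of set partitions of the coloured set of legs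 $[n]$ (leg $i$ has colour $\mathbf f(i)$), ordered by $\sigma\le\pi$ iff $\sigma$ refines $\pi$; let $\mathcal P=\bigcup_{\mathbf f}\mathcal P(\mathbf f)$. A symmetric universal product is *combinatorial with partition set* $\Pi\subset\mathcal P$ if its highest coefficients are $1$ on $\Pi$ and $0$ off $\Pi$, that is: for all $k,n\ge1$, all surjective $\mathbf b\colon[n]\to[k]$, all $\mathbf f\in\mathcal F^n$, all functionals $\varphi_\kappa$ on two-faced algebras $A_\kappa$ ($\kappa\in[k]$) and all $a_i\in A_{\mathbf b(i)}^{\mathbf f(i)}$, $$\frac{\partial^k}{\partial t_1\cdots\partial t_k}\Big|_{t=0}\big((t_1\varphi_1)\odot\cdots\odot(t_k\varphi_k)\big)(a_1\cdots a_n)=\alpha_\pi\prod_{\kappa=1}^k\varphi_\kappa\Big(\overrightarrow{\prod_{\mathbf b(i)=\kappa}}a_i\Big),$$ where $\pi\in\mathcal P(\mathbf f)$ has the blocks $\{i:\mathbf b(i)=\kappa\}$, and $\alpha_\pi=1$ if $\pi\in\Pi$, $\alpha_\pi=0$ otherwise (arrows: products in increasing order of indices). A leg $\ell$ of a partition is *inner*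 if there are $i<\ell<j$ in one block that does not contain $\ell$, otherwise it is *outer*. Consider the following 12 sets of two-coloured partitions: 1. all partitions; 2. interval partitions (all legs outer); 3. noncrossing partitions; 4. binoncrossing partitions: for blocks $\beta\ne\gamma$ and $i<j<k<\ell$: $i,k\in\beta$, $j,\ell\in\gamma$ implies $\mathbf f(j)\ne\mathbf f(k)$, and $i,\ell\in\beta$, $j,k\in\gamma$ implies $\mathbf f(j)=\mathbf f(k)$; 5. and 6. (for $c=\circ$ and $c=\bullet$): noncrossing partitions all of whose $c$-coloured legs are outer; 7. and 8. (for $c=\circ$ and $c=\bullet$): partitions all of whose $c$-coloured legs are outer; 9. and 10. (for $c=\circ$ and $c=\bullet$): partitions such that for all blocks $\beta\neq\gamma$ and legs $j,k\in\beta$, $i,\ell\in\gamma$ with $i<k<\ell$ and $\mathbf f(k)=c$ one has $i<j<\ell$ and $\mathbf f(j)=c$; 11. pure noncrossing partitions: noncrossing, and each block containing an inner leg is monochrome; 12. pure crossing partitions: for any two distinct blocks $\beta,\gamma$, all inner legs of the two-block partition $\{\beta,\gamma\}$ of $\beta\cup\gamma$ have the same colour. **Theorem 8.4.** Let $\odot$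 be a symmetric universal product which is combinatorial with partition set $\Pi$, where $\Pi$ is one of these 12 sets. Let $k,n\ge1$, let $\varphi_\kappa$ be a linear functional on a two-faced algebra $A_\kappa$ ($\kappa\in[k]$), let $\mathbf b\in[k]^n$, $\mathbf f\in\mathcal F^n$ and $a=a_1\cdots a_n\in A_1\sqcup\cdots\sqcup A_k$ with $a_i\in A_{\mathbf b(i)}^{\mathbf f(i)}$. Let $\pi\in\mathcal P(\mathbf f)$ be the partition whose blocks are the nonempty sets among $\{i:\mathbf b(i)=\kappa\}$, let $S$ be the set of maximal elements of $\{\sigma\in\Pi\cap\mathcal P(\mathbf f):\sigma\le\pi\}$, and for $R\subseteq S$ let $\wedge R$ be the coarsest common refinement of the elements of $R$. Put $\Phi:=\varphi_1\odot\cdots\odot\varphi_k$, and let $\hat\Phi=\Phi\circ\mu$ be its lift to the non-unital tensor algebra $T_0\big(\bigoplus_{\ell\in[k],q\in\mathcal F}A_\ell^q\big)$, where $\mu$ is the canonical homomorphism onto $A_1\sqcup\cdots\sqcup A_k$. Then $$\Phi(a)=\sum_{\emptyset\ne R\subseteq S}(-1)^{\#R-1}\,\hat\Phi^{\otimes|\wedge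 R|}(a_{\wedge R}),\qquad \hat\Phi^{\otimes|\rho|}(a_\rho):=\prod_{\beta\in\rho}\hat\Phi(a_\beta),$$ where $a_\beta=a_{i_1}\otimes\cdots\otimes a_{i_r}$ for a block $\beta=\{i_1<\cdots<i_r\}$. -/

import Mathlib

open scoped BigOperators Classical

set_option linter.unusedSectionVars false

universe u

noncomputable section

namespace MultiFaced

/-! ### Free products of (not necessarily unital) complex algebras -/

section FreeProduct

variable (A B : Type u)
  [NonUnitalRing A] [Module ℂ A] [IsScalarTower ℂ A A] [SMulCommClass ℂ A A]
  [NonUnitalRing B] [Module ℂ B] [IsScalarTower ℂ B B] [SMulCommClass ℂ B B]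

/-- The relations `a ⊗ a' = a a'` and `b ⊗ b' = b b'` on the tensor algebra of `A ⊕ B`. -/
inductive FreeProd.Rel : TensorAlgebra ℂ (A × B) → TensorAlgebra ℂ (A × B) → Prop
  | left (a a' : A) : FreeProd.Rel
      (TensorAlgebra.ι ℂ (a * a', (0 : B)))
      (TensorAlgebra.ι ℂ (a, (0 : B)) * TensorAlgebra.ι ℂ (a', (0 : B)))
  | right (b b' : B) : FreeProd.Rel
      (TensorAlgebra.ι ℂ ((0 : A), b * b'))
      (TensorAlgebra.ι ℂ ((0 : A), b) * TensorAlgebra.ι ℂ ((0 : A), b'))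

/-- The unital algebra `T(A ⊕ B) / (a ⊗ a' = a a', b ⊗ b' = b b')`; it is the unitization of the
free product of `A` and `B`. -/
abbrev FreeProd.Ambient : Type u := RingQuot (FreeProd.Rel A B)

/-- The canonical linear map of `A ⊕ B` into the ambient unital algebra. -/
def FreeProd.gen : (A × B) →ₗ[ℂ] FreeProd.Ambient A B :=
  (RingQuot.mkAlgHom ℂ (FreeProd.Rel A B)).toLinearMap ∘ₗ TensorAlgebra.ι ℂ

/-- The free product `A ⊔ B` of two non-unital algebras: the non-unital subalgebra generated by
`A` and `B` in `T(A ⊕ B) / (a ⊗ a' = a a', b ⊗ b' = b b')`. -/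
def FreeProd : Type u :=
  NonUnitalAlgebra.adjoin ℂ (Set.range (FreeProd.gen A B))

instance : NonUnitalRing (FreeProd A B) :=
  inferInstanceAs (NonUnitalRing (NonUnitalAlgebra.adjoin ℂ (Set.range (FreeProd.gen A B))))

instance : Module ℂ (FreeProd A B) :=
  inferInstanceAs (Module ℂ (NonUnitalAlgebra.adjoin ℂ (Set.range (FreeProd.gen A B))))

instance : IsScalarTower ℂ (FreeProd A B) (FreeProd A B) :=
  inferInstanceAs (IsScalarTower ℂ (NonUnitalAlgebra.adjoin ℂ (Set.range (FreeProd.gen A B)))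
    (NonUnitalAlgebra.adjoin ℂ (Set.range (FreeProd.gen A B))))

instance : SMulCommClass ℂ (FreeProd A B) (FreeProd A B) :=
  inferInstanceAs (SMulCommClass ℂ (NonUnitalAlgebra.adjoin ℂ (Set.range (FreeProd.gen A B)))
    (NonUnitalAlgebra.adjoin ℂ (Set.range (FreeProd.gen A B))))

/-- The inclusion of the free product into the ambient unital algebra. -/
def FreeProd.val : FreeProd A B →ₙₐ[ℂ] FreeProd.Ambient A B :=
  NonUnitalSubalgebraClass.subtype (NonUnitalAlgebra.adjoin ℂ (Set.range (FreeProd.gen A B)))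

variable {A B}

theorem FreeProd.val_injective : Function.Injective (FreeProd.val A B) := Subtype.val_injective

/-- The image of `(a, b)`, i.e. the sum of `a` and `b`, in the free product. -/
def FreeProd.of (p : A × B) : FreeProd A B :=
  ⟨FreeProd.gen A B p, NonUnitalAlgebra.subset_adjoin ℂ ⟨p, rfl⟩⟩

theorem FreeProd.val_of (p : A × B) : FreeProd.val A B (FreeProd.of p) = FreeProd.gen A B p := rfl

theorem FreeProd.of_add (p q : A × B) :
    FreeProd.of (p + q) = FreeProd.of p + FreeProd.of q :=
  FreeProd.val_injective <| by
    rw [map_add, FreeProd.val_of, FreeProd.val_of, FreeProd.val_of, map_add]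

theorem FreeProd.of_smul (c : ℂ) (p : A × B) :
    FreeProd.of (c • p) = c • FreeProd.of p :=
  FreeProd.val_injective <| by
    rw [map_smul, FreeProd.val_of, FreeProd.val_of, map_smul]

theorem FreeProd.of_zero : FreeProd.of (0 : A × B) = 0 :=
  FreeProd.val_injective <| by rw [map_zero, FreeProd.val_of, map_zero]

/-- The inclusion of the first factor. -/
def FreeProd.inl : A →ₙₐ[ℂ] FreeProd A B where
  toFun a := FreeProd.of (a, 0)
  map_smul' c a := by
    rw [← FreeProd.of_smul, Prod.smul_mk, smul_zero]; rfl
  map_zero' := FreeProd.of_zero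
  map_add' a a' := by rw [← FreeProd.of_add, Prod.mk_add_mk, add_zero]
  map_mul' a a' := FreeProd.val_injective <| by
    rw [map_mul, FreeProd.val_of, FreeProd.val_of, FreeProd.val_of]
    exact (RingQuot.mkAlgHom_rel ℂ (FreeProd.Rel.left (B := B) a a')).trans (map_mul _ _ _)

/-- The inclusion of the second factor. -/
def FreeProd.inr : B →ₙₐ[ℂ] FreeProd A B where
  toFun b := FreeProd.of (0, b)
  map_smul' c b := by
    rw [← FreeProd.of_smul, Prod.smul_mk, smul_zero]; rfl
  map_zero' := FreeProd.of_zero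
  map_add' b b' := by rw [← FreeProd.of_add, Prod.mk_add_mk, add_zero]
  map_mul' b b' := FreeProd.val_injective <| by
    rw [map_mul, FreeProd.val_of, FreeProd.val_of, FreeProd.val_of]
    exact (RingQuot.mkAlgHom_rel ℂ (FreeProd.Rel.right (A := A) b b')).trans (map_mul _ _ _)

theorem FreeProd.of_eq (a : A) (b : B) :
    FreeProd.of (a, b) = FreeProd.inl a + FreeProd.inr b := by
  change _ = FreeProd.of (a, 0) + FreeProd.of (0, b)
  rw [← FreeProd.of_add, Prod.mk_add_mk, add_zero, zero_add]

@[elab_as_elim]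
theorem FreeProd.induction {p : FreeProd A B → Prop} (hl : ∀ a, p (FreeProd.inl a))
    (hr : ∀ b, p (FreeProd.inr b)) (hadd : ∀ x y, p x → p y → p (x + y))
    (hmul : ∀ x y, p x → p y → p (x * y)) (hsmul : ∀ (c : ℂ) x, p x → p (c • x))
    (x : FreeProd A B) : p x := by
  obtain ⟨x, hx⟩ := x
  induction hx using NonUnitalAlgebra.adjoin_induction with
  | mem x hx =>
    obtain ⟨⟨a, b⟩, rfl⟩ := hx
    have h := hadd _ _ (hl a) (hr b)
    rw [← FreeProd.of_eq] at h
    exact h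
  | add x y hx hy h1 h2 => exact hadd _ _ h1 h2
  | zero =>
    have h := hl 0
    rw [map_zero] at h
    exact h
  | mul x y hx hy h1 h2 => exact hmul _ _ h1 h2
  | smul r x hx h1 => exact hsmul r _ h1

variable {C : Type u}
  [NonUnitalRing C] [Module ℂ C] [IsScalarTower ℂ C C] [SMulCommClass ℂ C C]

/-- The unital homomorphism on the ambient algebra induced by two homomorphisms. -/
def FreeProd.liftAux (f : A →ₙₐ[ℂ] C) (g : B →ₙₐ[ℂ] C) :
    FreeProd.Ambient A B →ₐ[ℂ] Unitization ℂ C :=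
  RingQuot.liftAlgHom ℂ
    ⟨TensorAlgebra.lift ℂ
      (Unitization.inrHom ℂ ℂ C ∘ₗ
        LinearMap.coprod (f : A →ₗ[ℂ] C) (g : B →ₗ[ℂ] C)), by
      intro x y h
      cases h with
      | left a a' => simp
      | right b b' => simp⟩

theorem FreeProd.liftAux_gen (f : A →ₙₐ[ℂ] C) (g : B →ₙₐ[ℂ] C) (p : A × B) :
    FreeProd.liftAux f g (FreeProd.gen A B p) = ((f p.1 + g p.2 : C) : Unitization ℂ C) := by
  simp [FreeProd.liftAux, FreeProd.gen]

theorem FreeProd.liftAux_fst (f : A →ₙₐ[ℂ] C) (g : B →ₙₐ[ℂ] C) (x : FreeProd A B) :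
    (FreeProd.liftAux f g (FreeProd.val A B x)).fst = 0 := by
  induction x using FreeProd.induction with
  | hl a =>
    change (FreeProd.liftAux f g (FreeProd.gen A B (a, 0))).fst = 0
    rw [FreeProd.liftAux_gen, Unitization.fst_inr]
  | hr b =>
    change (FreeProd.liftAux f g (FreeProd.gen A B (0, b))).fst = 0
    rw [FreeProd.liftAux_gen, Unitization.fst_inr]
  | hadd x y h1 h2 => rw [map_add, map_add, Unitization.fst_add, h1, h2, add_zero]
  | hmul x y h1 h2 => rw [map_mul, map_mul, Unitization.fst_mul, h1, zero_mul]
  | hsmul c x h => rw [map_smul, map_smul, Unitization.fst_smul, h, smul_zero]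

/-- The homomorphism `A ⊔ B → C` induced by `A → C` and `B → C`. -/
def FreeProd.lift (f : A →ₙₐ[ℂ] C) (g : B →ₙₐ[ℂ] C) : FreeProd A B →ₙₐ[ℂ] C where
  toFun x := (FreeProd.liftAux f g (FreeProd.val A B x)).snd
  map_smul' c x := by rw [map_smul, map_smul, Unitization.snd_smul]; rfl
  map_zero' := by rw [map_zero, map_zero, Unitization.snd_zero]
  map_add' x y := by rw [map_add, map_add, Unitization.snd_add]
  map_mul' x y := by
    rw [map_mul, map_mul, Unitization.snd_mul, FreeProd.liftAux_fst, FreeProd.liftAux_fst,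
      zero_smul, zero_smul, zero_add, zero_add]

theorem FreeProd.lift_inl (f : A →ₙₐ[ℂ] C) (g : B →ₙₐ[ℂ] C) (a : A) :
    FreeProd.lift f g (FreeProd.inl a) = f a := by
  change (FreeProd.liftAux f g (FreeProd.gen A B (a, 0))).snd = f a
  rw [FreeProd.liftAux_gen, Unitization.snd_inr, map_zero, add_zero]

theorem FreeProd.lift_inr (f : A →ₙₐ[ℂ] C) (g : B →ₙₐ[ℂ] C) (b : B) :
    FreeProd.lift f g (FreeProd.inr b) = g b := by
  change (FreeProd.liftAux f g (FreeProd.gen A B (0, b))).snd = g b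
  rw [FreeProd.liftAux_gen, Unitization.snd_inr, map_zero, zero_add]

theorem FreeProd.hom_ext {h h' : FreeProd A B →ₙₐ[ℂ] C}
    (hl : ∀ a, h (FreeProd.inl a) = h' (FreeProd.inl a))
    (hr : ∀ b, h (FreeProd.inr b) = h' (FreeProd.inr b)) : h = h' := by
  refine NonUnitalAlgHom.ext fun x => ?_
  induction x using FreeProd.induction with
  | hl a => exact hl a
  | hr b => exact hr b
  | hadd x y h1 h2 => rw [map_add, map_add, h1, h2]
  | hmul x y h1 h2 => rw [map_mul, map_mul, h1, h2]
  | hsmul c x h1 => rw [map_smul, map_smul, h1]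

end FreeProduct

/-! ### Multi-faced algebras -/

/-- A multi-faced algebra with faces indexed by `F`: a (not necessarily unital) complex associative
algebra which is freely generated by given subalgebras `face q`, i.e. it is the free product
(coproduct) of its faces. -/
structure FacedAlg (F : Type) : Type (u + 1) where
  carrier : Type u
  [ring : NonUnitalRing carrier]
  [module : Module ℂ carrier]
  [tower : IsScalarTower ℂ carrier carrier]
  [comm : SMulCommClass ℂ carrier carrier]
  face : F → NonUnitalSubalgebra ℂ carrier
  free : ∀ (C : Type u) [NonUnitalRing C] [Module ℂ C] [IsScalarTower ℂ C C] [SMulCommClass ℂ C C]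
    (g : ∀ q, face q →ₙₐ[ℂ] C),
    ∃! h : carrier →ₙₐ[ℂ] C, ∀ (q : F) (x : face q), h (x : carrier) = g q x

attribute [instance] FacedAlg.ring FacedAlg.module FacedAlg.tower FacedAlg.comm

instance (F : Type) : CoeSort (FacedAlg.{u} F) (Type u) := ⟨FacedAlg.carrier⟩

variable {F : Type}

/-- Linear functionals on a multi-faced algebra. -/
abbrev FacedAlg.Functional (A : FacedAlg.{u} F) : Type u := A →ₗ[ℂ] ℂ

/-- The free product of two multi-faced algebras, with faces `A^q ⊔ B^q`. -/
def FacedAlg.coprod (A B : FacedAlg.{u} F) : FacedAlg.{u} F where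
  carrier := FreeProd A B
  face q := (A.face q).map (FreeProd.inl : A →ₙₐ[ℂ] FreeProd A B) ⊔
    (B.face q).map (FreeProd.inr : B →ₙₐ[ℂ] FreeProd A B)
  free := by
    intro C _ _ _ _ g
    let L : ∀ q, A.face q →ₙₐ[ℂ] C := fun q =>
      (g q).comp (NonUnitalAlgHom.codRestrict
        ((FreeProd.inl : A →ₙₐ[ℂ] FreeProd A B).comp
          (NonUnitalSubalgebraClass.subtype (A.face q))) _
        (fun x => (le_sup_left : _ ≤ (A.face q).map (FreeProd.inl : A →ₙₐ[ℂ] FreeProd A B) ⊔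
          (B.face q).map (FreeProd.inr : B →ₙₐ[ℂ] FreeProd A B)) ⟨x, x.2, rfl⟩))
    let R : ∀ q, B.face q →ₙₐ[ℂ] C := fun q =>
      (g q).comp (NonUnitalAlgHom.codRestrict
        ((FreeProd.inr : B →ₙₐ[ℂ] FreeProd A B).comp
          (NonUnitalSubalgebraClass.subtype (B.face q))) _
        (fun x => (le_sup_right : _ ≤ (A.face q).map (FreeProd.inl : A →ₙₐ[ℂ] FreeProd A B) ⊔
          (B.face q).map (FreeProd.inr : B →ₙₐ[ℂ] FreeProd A B)) ⟨x, x.2, rfl⟩))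
    obtain ⟨l, hl, hl'⟩ := A.free C L
    obtain ⟨r, hr, hr'⟩ := B.free C R
    refine ⟨FreeProd.lift l r, ?_, ?_⟩
    · rintro q ⟨x, hx⟩
      have key : ∀ y (hy : y ∈ NonUnitalAlgebra.adjoin ℂ
          ((FreeProd.inl : A →ₙₐ[ℂ] FreeProd A B) '' (A.face q) ∪
            (FreeProd.inr : B →ₙₐ[ℂ] FreeProd A B) '' (B.face q))),
          ∃ hy' : y ∈ (A.face q).map (FreeProd.inl : A →ₙₐ[ℂ] FreeProd A B) ⊔
            (B.face q).map (FreeProd.inr : B →ₙₐ[ℂ] FreeProd A B),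
            FreeProd.lift l r y = g q ⟨y, hy'⟩ := by
        intro y hy
        induction hy using NonUnitalAlgebra.adjoin_induction with
        | mem y hy =>
          rcases hy with ⟨a, ha, rfl⟩ | ⟨b, hb, rfl⟩
          · exact ⟨le_sup_left (α := NonUnitalSubalgebra ℂ (FreeProd A B)) ⟨a, ha, rfl⟩,
              (FreeProd.lift_inl l r a).trans (hl q ⟨a, ha⟩)⟩
          · exact ⟨le_sup_right (α := NonUnitalSubalgebra ℂ (FreeProd A B)) ⟨b, hb, rfl⟩,
              (FreeProd.lift_inr l r b).trans (hr q ⟨b, hb⟩)⟩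
        | add y z _ _ h1 h2 =>
          obtain ⟨m1, e1⟩ := h1
          obtain ⟨m2, e2⟩ := h2
          exact ⟨add_mem m1 m2, by
            rw [map_add, e1, e2]; exact ((g q).map_add ⟨y, m1⟩ ⟨z, m2⟩).symm⟩
        | zero => exact ⟨zero_mem _, by rw [map_zero]; exact ((g q).map_zero).symm⟩
        | mul y z _ _ h1 h2 =>
          obtain ⟨m1, e1⟩ := h1
          obtain ⟨m2, e2⟩ := h2
          exact ⟨mul_mem m1 m2, by
            rw [map_mul, e1, e2]; exact ((g q).map_mul ⟨y, m1⟩ ⟨z, m2⟩).symm⟩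
        | smul c y _ h1 =>
          obtain ⟨m1, e1⟩ := h1
          exact ⟨SMulMemClass.smul_mem c m1, by
            rw [map_smul, e1]; exact ((g q).map_smul c ⟨y, m1⟩).symm⟩
      have hle : (A.face q).map (FreeProd.inl : A →ₙₐ[ℂ] FreeProd A B) ⊔
          (B.face q).map (FreeProd.inr : B →ₙₐ[ℂ] FreeProd A B) ≤
          NonUnitalAlgebra.adjoin ℂ
            ((FreeProd.inl : A →ₙₐ[ℂ] FreeProd A B) '' (A.face q) ∪
              (FreeProd.inr : B →ₙₐ[ℂ] FreeProd A B) '' (B.face q)) := by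
        refine sup_le ?_ ?_
        · rintro _ ⟨a, ha, rfl⟩
          exact NonUnitalAlgebra.subset_adjoin ℂ (Or.inl ⟨a, ha, rfl⟩)
        · rintro _ ⟨b, hb, rfl⟩
          exact NonUnitalAlgebra.subset_adjoin ℂ (Or.inr ⟨b, hb, rfl⟩)
      exact (key x (hle hx)).2
    · intro h hh
      have e1 : h.comp (FreeProd.inl : A →ₙₐ[ℂ] FreeProd A B) = l :=
        hl' _ (fun q x => hh q ⟨FreeProd.inl (x : A),
          le_sup_left (α := NonUnitalSubalgebra ℂ (FreeProd A B)) ⟨x, x.2, rfl⟩⟩)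
      have e2 : h.comp (FreeProd.inr : B →ₙₐ[ℂ] FreeProd A B) = r :=
        hr' _ (fun q x => hh q ⟨FreeProd.inr (x : B),
          le_sup_right (α := NonUnitalSubalgebra ℂ (FreeProd A B)) ⟨x, x.2, rfl⟩⟩)
      refine FreeProd.hom_ext (fun a => ?_) (fun b => ?_)
      · rw [FreeProd.lift_inl, ← e1]; rfl
      · rw [FreeProd.lift_inr, ← e2]; rfl

/-- The canonical inclusion of the first factor into a free product. -/
def FacedAlg.inl (A B : FacedAlg.{u} F) : A →ₙₐ[ℂ] A.coprod B :=
  (FreeProd.inl : A →ₙₐ[ℂ] FreeProd A B)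

/-- The canonical inclusion of the second factor into a free product. -/
def FacedAlg.inr (A B : FacedAlg.{u} F) : B →ₙₐ[ℂ] A.coprod B :=
  (FreeProd.inr : B →ₙₐ[ℂ] FreeProd A B)

/-- The homomorphism out of a free product induced by homomorphisms on the factors. -/
def FacedAlg.desc {A B C : FacedAlg.{u} F} (f : A →ₙₐ[ℂ] C) (g : B →ₙₐ[ℂ] C) :
    A.coprod B →ₙₐ[ℂ] C :=
  (FreeProd.lift f g : FreeProd A B →ₙₐ[ℂ] C)

theorem FacedAlg.desc_inl {A B C : FacedAlg.{u} F} (f : A →ₙₐ[ℂ] C) (g : B →ₙₐ[ℂ] C) (a : A) :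
    FacedAlg.desc f g (FacedAlg.inl A B a) = f a :=
  FreeProd.lift_inl f g a

theorem FacedAlg.desc_inr {A B C : FacedAlg.{u} F} (f : A →ₙₐ[ℂ] C) (g : B →ₙₐ[ℂ] C) (b : B) :
    FacedAlg.desc f g (FacedAlg.inr A B b) = g b :=
  FreeProd.lift_inr f g b

theorem FacedAlg.coprod_hom_ext {A B C : FacedAlg.{u} F} {h h' : A.coprod B →ₙₐ[ℂ] C}
    (hl : ∀ a, h (FacedAlg.inl A B a) = h' (FacedAlg.inl A B a))
    (hr : ∀ b, h (FacedAlg.inr A B b) = h' (FacedAlg.inr A B b)) : h = h' :=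
  FreeProd.hom_ext (A := A) (B := B) hl hr

/-- The canonical identification `A ⊔ B = B ⊔ A`. -/
def FacedAlg.swap (A B : FacedAlg.{u} F) : A.coprod B →ₙₐ[ℂ] B.coprod A :=
  FacedAlg.desc (FacedAlg.inr B A) (FacedAlg.inl B A)

/-- The canonical identification `(A ⊔ B) ⊔ C = A ⊔ (B ⊔ C)`. -/
def FacedAlg.assoc (A B C : FacedAlg.{u} F) :
    (A.coprod B).coprod C →ₙₐ[ℂ] A.coprod (B.coprod C) :=
  FacedAlg.desc
    (FacedAlg.desc (FacedAlg.inl A (B.coprod C))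
      ((FacedAlg.inr A (B.coprod C)).comp (FacedAlg.inl B C)))
    ((FacedAlg.inr A (B.coprod C)).comp (FacedAlg.inr B C))

/-- The canonical map `h₁ ⊔ h₂ : A₁ ⊔ A₂ → B₁ ⊔ B₂`. -/
def FacedAlg.map {A₁ A₂ B₁ B₂ : FacedAlg.{u} F} (h₁ : A₁ →ₙₐ[ℂ] B₁) (h₂ : A₂ →ₙₐ[ℂ] B₂) :
    A₁.coprod A₂ →ₙₐ[ℂ] B₁.coprod B₂ :=
  FacedAlg.desc ((FacedAlg.inl B₁ B₂).comp h₁) ((FacedAlg.inr B₁ B₂).comp h₂)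

/-- An algebra homomorphism between multi-faced algebras is multi-faced if it maps each face into
the corresponding face. -/
def IsFacedHom {A B : FacedAlg.{u} F} (h : A →ₙₐ[ℂ] B) : Prop :=
  ∀ (q : F) (x : A), x ∈ A.face q → h x ∈ B.face q

/-! ### Universal products -/

/-- A multi-faced universal product. -/
structure UniversalProduct (F : Type) where
  op : ∀ {A B : FacedAlg.{u} F}, A.Functional → B.Functional → (A.coprod B).Functional
  universal : ∀ {A₁ A₂ B₁ B₂ : FacedAlg.{u} F} (φ₁ : A₁.Functional) (φ₂ : A₂.Functional)
    (h₁ : B₁ →ₙₐ[ℂ] A₁) (h₂ : B₂ →ₙₐ[ℂ] A₂), IsFacedHom h₁ → IsFacedHom h₂ →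
    op (φ₁ ∘ₗ (h₁ : B₁ →ₗ[ℂ] A₁)) (φ₂ ∘ₗ (h₂ : B₂ →ₗ[ℂ] A₂)) =
      op φ₁ φ₂ ∘ₗ (FacedAlg.map h₁ h₂ : B₁.coprod B₂ →ₗ[ℂ] A₁.coprod A₂)
  associative : ∀ {A B C : FacedAlg.{u} F} (φ₁ : A.Functional) (φ₂ : B.Functional)
    (φ₃ : C.Functional) (x : (A.coprod B).coprod C),
    op (op φ₁ φ₂) φ₃ x = op φ₁ (op φ₂ φ₃) (FacedAlg.assoc A B C x)
  restrict_left : ∀ {A B : FacedAlg.{u} F} (φ₁ : A.Functional) (φ₂ : B.Functional) (a : A),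
    op φ₁ φ₂ (FacedAlg.inl A B a) = φ₁ a
  restrict_right : ∀ {A B : FacedAlg.{u} F} (φ₁ : A.Functional) (φ₂ : B.Functional) (b : B),
    op φ₁ φ₂ (FacedAlg.inr A B b) = φ₂ b

/-- A universal product is symmetric if `φ₁ ⊙ φ₂ = φ₂ ⊙ φ₁`. -/
def UniversalProduct.IsSymmetric (P : UniversalProduct.{u} F) : Prop :=
  ∀ {A B : FacedAlg.{u} F} (φ₁ : A.Functional) (φ₂ : B.Functional) (x : A.coprod B),
    P.op φ₁ φ₂ x = P.op φ₂ φ₁ (FacedAlg.swap A B x)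

/-- The free product `A₀ ⊔ (A₁ ⊔ (⋯ ⊔ A_k))` of a nonempty finite family. -/
def FacedAlg.iter : {k : ℕ} → (Fin (k + 1) → FacedAlg.{u} F) → FacedAlg.{u} F
  | 0, A => A 0
  | _ + 1, A => (A 0).coprod (FacedAlg.iter fun i => A i.succ)

/-- The canonical inclusion of a factor into the free product of a nonempty finite family. -/
def FacedAlg.incl : {k : ℕ} → (A : Fin (k + 1) → FacedAlg.{u} F) → (κ : Fin (k + 1)) →
    (A κ →ₙₐ[ℂ] FacedAlg.iter A)
  | 0, A => fun κ => Fin.cases (motive := fun κ => A κ →ₙₐ[ℂ] A 0)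
      (NonUnitalAlgHom.id ℂ (A 0)) (fun i => i.elim0) κ
  | _ + 1, A => fun κ => Fin.cases
      (motive := fun κ => A κ →ₙₐ[ℂ] (A 0).coprod (FacedAlg.iter fun i => A i.succ))
      (FacedAlg.inl (A 0) (FacedAlg.iter fun i => A i.succ))
      (fun i => (FacedAlg.inr (A 0) (FacedAlg.iter fun i => A i.succ)).comp
        (FacedAlg.incl (fun i => A i.succ) i)) κ

/-- The iterated product `φ₀ ⊙ (φ₁ ⊙ (⋯ ⊙ φ_k))`. -/
def UniversalProduct.iter (P : UniversalProduct.{u} F) : {k : ℕ} →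
    (A : Fin (k + 1) → FacedAlg.{u} F) → (∀ κ, (A κ).Functional) → (FacedAlg.iter A).Functional
  | 0, _, φ => φ 0
  | _ + 1, A, φ => P.op (φ 0) (P.iter (fun i => A i.succ) fun i => φ i.succ)

/-- The product of a nonempty list in a non-unital ring (the empty list gets the value `0`, which is
never used). -/
def nprod {R : Type*} [NonUnitalRing R] : List R → R
  | [] => 0
  | [x] => x
  | x :: y :: l => x * nprod (y :: l)

/-! ### Partitions and highest coefficients -/

/-- Set partitions of the `n` legs, ordered by refinement: `σ ≤ π` iff `σ` refines `π`, and `⊤` is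
the one-block partition. A multi-faced partition is such a partition together with a face
structure `f : Fin n → F`. -/
abbrev LegPartition (n : ℕ) : Type := Finpartition (Finset.univ : Finset (Fin n))

/-- A set `Π` of multi-faced partitions: `Π n f` is the set of those members of `Π` which have
`n` legs and face structure `f`. -/
abbrev PartitionSet (F : Type) : Type := ∀ n : ℕ, (Fin n → F) → Set (LegPartition n)

/-- The partition of the legs into the nonempty sets `{i | b i = κ}`. -/
def blockPartition {n k : ℕ} (b : Fin n → Fin k) : LegPartition n :=
  Finpartition.ofSetoid (Setoid.ker b)

/-- The iterated partial derivative `∂^k / ∂t₁ ⋯ ∂t_k` at `t = 0` of a function of `k` variables. -/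
def mixedPartial : (k : ℕ) → ((Fin k → ℂ) → ℂ) → ℂ
  | 0, g => g Fin.elim0
  | k + 1, g => deriv (fun t : ℂ => mixedPartial k fun s => g (Fin.cons t s)) 0

/-- The weights on partitions `α` are the highest coefficients of the universal product `P`: for
every block structure `b` in which each of the `k + 1` labels occurs, every face structure `f` and
all `a i ∈ A_{b i}^{f i}`, the linearized part of the product is
`α_π · ∏_κ φ_κ(∏_{b i = κ} a i)`, where `π` has the blocks `{i | b i = κ}` and the factors are
multiplied in increasing order of `i`.
Only the entries `a (b i) i` of the family `a` play a role. -/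
def UniversalProduct.HasHighestCoefficients (P : UniversalProduct.{u} F)
    (α : ∀ n : ℕ, (Fin n → F) → LegPartition n → ℂ) : Prop :=
  ∀ (k n : ℕ) (b : Fin n → Fin (k + 1)) (f : Fin n → F), Function.Surjective b →
    ∀ (A : Fin (k + 1) → FacedAlg.{u} F) (φ : ∀ κ, (A κ).Functional)
      (a : ∀ κ, Fin n → A κ), (∀ i, a (b i) i ∈ (A (b i)).face (f i)) →
      mixedPartial (k + 1) (fun t => P.iter A (fun κ => t κ • φ κ)
          (nprod (List.ofFn fun i => FacedAlg.incl A (b i) (a (b i) i)))) =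
        α n f (blockPartition b) *
          ∏ κ, φ κ (nprod (((Finset.univ.filter fun i => b i = κ).sort (· ≤ ·)).map (a κ)))

/-- A universal product is combinatorial with partition set `Π` if it is symmetric and its highest
coefficients are `1` on `Π` and `0` outside of `Π`. -/
def UniversalProduct.IsCombinatorial (P : UniversalProduct.{u} F) (Pi : PartitionSet F) : Prop :=
  P.IsSymmetric ∧
    P.HasHighestCoefficients fun n f π => if π ∈ Pi n f then 1 else 0

/-! ### The twelve admissible sets of two-faced partitions -/

/-- The two faces. -/
inductive Color : Type
  | white
  | black

/-- The leg `l` lies strictly between two legs of the block `γ`. -/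
def Between {n : ℕ} (γ : Finset (Fin n)) (l : Fin n) : Prop :=
  ∃ i ∈ γ, ∃ j ∈ γ, i < l ∧ l < j

/-- A leg is inner if it lies strictly between two legs of a block it does not belong to. -/
def IsInner {n : ℕ} (π : LegPartition n) (l : Fin n) : Prop :=
  ∃ γ ∈ π.parts, l ∉ γ ∧ Between γ l

/-- The partition is noncrossing. -/
def IsNoncrossing {n : ℕ} (π : LegPartition n) : Prop :=
  ∀ β ∈ π.parts, ∀ γ ∈ π.parts, ∀ i j k l : Fin n, i < j → j < k → k < l →
    i ∈ β → k ∈ β → j ∈ γ → l ∈ γ → β = γ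

/-- All partitions. -/
def setA : PartitionSet Color := fun _ _ => Set.univ

/-- Interval partitions: all legs are outer. -/
def setI : PartitionSet Color := fun _ _ => {π | ∀ l, ¬ IsInner π l}

/-- Noncrossing partitions. -/
def setNC : PartitionSet Color := fun _ _ => {π | IsNoncrossing π}

/-- Binoncrossing partitions. -/
def setBiNC : PartitionSet Color := fun _ f => {π |
  ∀ β ∈ π.parts, ∀ γ ∈ π.parts, β ≠ γ → ∀ i j k l : Fin _, i < j → j < k → k < l →
    ((i ∈ β → k ∈ β → j ∈ γ → l ∈ γ → f j ≠ f k) ∧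
     (i ∈ β → l ∈ β → j ∈ γ → k ∈ γ → f j = f k))}

/-- Noncrossing partitions all of whose `c`-legs are outer: interval-noncrossing for
`c = white`, noncrossing-interval for `c = black`. -/
def setINC (c : Color) : PartitionSet Color := fun _ f =>
  {π | IsNoncrossing π ∧ ∀ l, f l = c → ¬ IsInner π l}

/-- Partitions all of whose `c`-legs are outer: interval-arbitrary for `c = white`,
arbitrary-interval for `c = black`. -/
def setIA (c : Color) : PartitionSet Color := fun _ f => {π | ∀ l, f l = c → ¬ IsInner π l}

/-- Partitions in which every block that contains an inner `c`-leg is monochrome and does not cross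
any other block: noncrossing-arbitrary for `c = white`, arbitrary-noncrossing for `c = black`. -/
def setNCA (c : Color) : PartitionSet Color := fun _ f => {π |
  ∀ β ∈ π.parts, ∀ γ ∈ π.parts, β ≠ γ → ∀ i j k l : Fin _,
    j ∈ β → k ∈ β → i ∈ γ → l ∈ γ → i < k → k < l → f k = c → i < j ∧ j < l ∧ f j = c}

/-- Pure noncrossing partitions: noncrossing, and all inner blocks are monochrome. (In a noncrossing
partition, a block with an inner leg has only inner legs.) -/
def setPNC : PartitionSet Color := fun _ f => {π | IsNoncrossing π ∧
  ∀ β ∈ π.parts, (∃ l ∈ β, IsInner π l) → ∀ i ∈ β, ∀ j ∈ β, f i = f j}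

/-- The leg `l` of the two-block partition `{β, γ}` is inner. -/
def IsInnerPair {n : ℕ} (β γ : Finset (Fin n)) (l : Fin n) : Prop :=
  (l ∈ β ∧ Between γ l) ∨ (l ∈ γ ∧ Between β l)

/-- Pure crossing partitions: for any two distinct blocks, the inner legs of the two-block
partition formed by them have the same colour. -/
def setPC : PartitionSet Color := fun _ f => {π |
  ∀ β ∈ π.parts, ∀ γ ∈ π.parts, β ≠ γ → ∀ l l' : Fin _,
    IsInnerPair β γ l → IsInnerPair β γ l' → f l = f l'}

/-- The twelve admissible sets of two-faced partitions. -/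
def twelveSets : Set (PartitionSet Color) :=
  {setI, setNC, setBiNC, setINC .white, setINC .black, setIA .white, setIA .black,
    setNCA .white, setNCA .black, setPNC, setPC, setA}

/-! ### The lift to the tensor algebra and the coarsest refinements -/

/-- The vector space `⨁_{ℓ, q} A_ℓ^q`. -/
abbrev FaceSum {k : ℕ} (A : Fin (k + 1) → FacedAlg.{u} F) : Type u :=
  DirectSum (Fin (k + 1) × F) fun p => (A p.1).face p.2

/-- The elementary tensor of degree one given by an element of the face `A_ℓ^q`. -/
def faceTensor {k : ℕ} (A : Fin (k + 1) → FacedAlg.{u} F) (κ : Fin (k + 1)) (q : F)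
    (x : (A κ).face q) : TensorAlgebra ℂ (FaceSum A) :=
  TensorAlgebra.ι ℂ
    (DirectSum.lof ℂ (Fin (k + 1) × F) (fun p => (A p.1).face p.2) (κ, q) x)

/-- The canonical homomorphism `μ` from `T(⨁_{ℓ, q} A_ℓ^q)` to the unitization of the free product;
it maps the non-unital part `T₀` into the free product. -/
def multiplication {k : ℕ} (A : Fin (k + 1) → FacedAlg.{u} F) :
    TensorAlgebra ℂ (FaceSum A) →ₐ[ℂ] Unitization ℂ (FacedAlg.iter A) :=
  TensorAlgebra.lift ℂ <| DirectSum.toModule ℂ (Fin (k + 1) × F) _ fun p =>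
    Unitization.inrHom ℂ ℂ (FacedAlg.iter A) ∘ₗ
      (FacedAlg.incl A p.1 : A p.1 →ₗ[ℂ] FacedAlg.iter A) ∘ₗ
        ((A p.1).face p.2).toSubmodule.subtype

/-- The lift `Φ ∘ μ` of a functional `Φ` on the free product to the non-unital tensor algebra
`T₀(⨁_{ℓ, q} A_ℓ^q)`, extended to `T(⨁_{ℓ, q} A_ℓ^q) = ℂ1 ⊕ T₀` by annihilating the unit. -/
def liftFunctional {k : ℕ} (A : Fin (k + 1) → FacedAlg.{u} F)
    (Φ : (FacedAlg.iter A).Functional) : TensorAlgebra ℂ (FaceSum A) →ₗ[ℂ] ℂ :=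
  Φ ∘ₗ Unitization.sndHom ℂ ℂ (FacedAlg.iter A) ∘ₗ (multiplication A).toLinearMap

/-- The number `ψ^{⊗|ρ|}(x_ρ) = ∏_{β ∈ ρ} ψ(x_β)`, where `x_β` is the product of the `x i`, `i ∈ β`,
in increasing order of `i`. -/
def tensorPowerEval {T : Type*} [Ring T] [Module ℂ T] {n : ℕ} (ψ : T →ₗ[ℂ] ℂ) (ρ : LegPartition n)
    (x : Fin n → T) : ℂ :=
  ∏ β ∈ ρ.parts, ψ (((β.sort (· ≤ ·)).map x).prod)

/-- The coarsest refinements of `π` inside `Π`: the maximal elements of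
`{σ ∈ Π | σ ≤ π}`. -/
def coarsestRefinements {n : ℕ} (Pi : PartitionSet F) (f : Fin n → F) (π : LegPartition n) :
    Finset (LegPartition n) :=
  Finset.univ.filter fun σ => Maximal (fun τ => τ ∈ Pi n f ∧ τ ≤ π) σ

/-- The maximal common refinement of a finite set of partitions (`⊤` for the empty set). -/
def meet {n : ℕ} (R : Finset (LegPartition n)) : LegPartition n := R.inf id

end MultiFaced

end

/-! The formula is inclusion-exclusion applied to a moment-cumulant formula. Suppose numbers `C w`,
attached to words in the legs, vanish on words mixing different labels, and each mixed moment, the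
full one or one of a block `a_β`, is the sum over partitions in `Π` of the products of `C` over
blocks. Then only partitions `σ ≤ π` contribute to `Φ(a)`. They form the union of the down-sets,
inside `Π`, of the maximal elements `S`, and the down-sets of the members of `R ⊆ S` intersect in
the down-set of `∧R`. Finally the sum over the down-set of `∧R` factorizes over the blocks of `∧R`
into the moments `Φ(a_β)`.

The last two steps use only that membership in `Π` is a condition on pairs of blocks, inherited by
subsets and invariant under order embeddings (`IsPairwise`): then `∧R` lies in `Π`
(`IsPairwise.meet_mem`), and refining a member of `Π` inside `Π` means choosing independently a
member of `Π` on each of its blocks (`IsPairwise.prod_sum_blocks`). The twelve sets enter only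
through this property.

The moment-cumulant formula (`exists_moment_cumulant`) comes from the commutative monoid of
functionals on a free multi-faced algebra under convolution, `(φ ⊙ ψ) ∘ diag`. The moments of `Φ`
are values of a convolution of pullbacks of the `φ κ` (`convProd_pull_lift`). The coefficient of the
one-block partition is 1, so cumulants of each `φ κ` exist by recursion on the length of words
(`exists_cumulants`). Values of a convolution at words without repeated letters depend only on such
values of the factors (`AgreeOnNodup.convProd`), so each `φ κ` may be replaced by a convolution of
functionals supported on single words. For these, homogeneity in the letters turns the derivative
defining the highest coefficients into the value itself (`convProd_finRange`). -/

noncomputable section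

namespace MultiFaced

variable {F : Type}

/-! ### Products of nonempty lists -/

section NProd

variable {R : Type*} [NonUnitalRing R]

theorem nprod_singleton (x : R) : nprod [x] = x := rfl

theorem nprod_cons (x : R) {l : List R} (hl : l ≠ []) : nprod (x :: l) = x * nprod l := by
  cases l with
  | nil => exact absurd rfl hl
  | cons y l => rfl

theorem nprod_append {l l' : List R} (hl : l ≠ []) (hl' : l' ≠ []) :
    nprod (l ++ l') = nprod l * nprod l' := by
  induction l with
  | nil => exact absurd rfl hl
  | cons x l ih =>
    by_cases h : l = []
    · subst h
      rw [List.singleton_append, nprod_cons _ hl', nprod_singleton]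
    · rw [List.cons_append, nprod_cons _ (by simp [h]), ih h, nprod_cons _ h, mul_assoc]

/-- The default value `0` of the empty product is preserved by `h`, so no nonemptiness is required.
-/
theorem map_nprod {S G : Type*} [NonUnitalRing S] [FunLike G R S] [NonUnitalRingHomClass G R S]
    (h : G) (l : List R) : h (nprod l) = nprod (l.map h) := by
  induction l with
  | nil => exact map_zero h
  | cons x l ih =>
    by_cases hl : l = []
    · subst hl; rfl
    · rw [nprod_cons _ hl, map_mul, ih, List.map_cons, nprod_cons _ (by simp [hl])]

theorem nprod_eq_zero {l : List R} (h : (0 : R) ∈ l) : nprod l = 0 := by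
  induction l with
  | nil => rfl
  | cons x l ih =>
    by_cases hl : l = []
    · subst hl
      rw [List.mem_singleton] at h
      exact h.symm
    · rw [nprod_cons _ hl]
      rcases List.mem_cons.1 h with h | h
      · rw [← h, zero_mul]
      · rw [ih h, mul_zero]

variable [Module ℂ R] [IsScalarTower ℂ R R] [SMulCommClass ℂ R R]

theorem inr_nprod {l : List R} (hl : l ≠ []) :
    ((nprod l : R) : Unitization ℂ R) = (l.map (fun x : R => (x : Unitization ℂ R))).prod := by
  induction l with
  | nil => exact absurd rfl hl
  | cons x l ih =>
    by_cases h : l = []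
    · subst h; simp [nprod]
    · rw [nprod_cons _ h, Unitization.inr_mul, ih h, List.map_cons, List.prod_cons]

theorem nprod_map_smul {ι : Type*} {l : List ι} (hl : l ≠ []) (c : ι → ℂ) (x : ι → R) :
    nprod (l.map fun i => c i • x i) = (l.map c).prod • nprod (l.map x) := by
  induction l with
  | nil => exact absurd rfl hl
  | cons i l ih =>
    by_cases h : l = []
    · subst h; simp [nprod]
    · rw [List.map_cons, nprod_cons _ (by simp [h]), ih h, List.map_cons, List.map_cons,
        nprod_cons _ (by simp [h]), List.prod_cons, smul_mul_smul_comm]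

/-- This is multilinearity of the product, transported to the unitization, where `nprod` of a
nonempty list becomes an ordinary product. -/
theorem nprod_ofFn_sum {n : ℕ} (hn : n ≠ 0) {S : Type*} [Fintype S] (g : Fin n → S → R) :
    nprod (List.ofFn fun i => ∑ s, g i s) =
      ∑ j : Fin n → S, nprod (List.ofFn fun i => g i (j i)) := by
  have hne : ∀ y : Fin n → R, List.ofFn y ≠ [] := fun y h => hn (List.ofFn_eq_nil_iff.1 h)
  apply Unitization.inr_injective (R := ℂ)
  rw [inr_nprod (hne _), List.map_ofFn]
  have key := (MultilinearMap.mkPiAlgebraFin ℂ n (Unitization ℂ R)).map_sum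
    (fun i s => (g i s : Unitization ℂ R))
  simp only [MultilinearMap.mkPiAlgebraFin_apply] at key
  have hs : ∀ {ι : Type _} (t : Finset ι) (y : ι → R),
      ((∑ i ∈ t, y i : R) : Unitization ℂ R) = ∑ i ∈ t, (y i : Unitization ℂ R) :=
    fun t y => map_sum (Unitization.inrHom ℂ ℂ R) y t
  have e1 : ((fun x : R => (x : Unitization ℂ R)) ∘ fun i => ∑ s, g i s) =
      fun i => ∑ s, (g i s : Unitization ℂ R) := funext fun i => hs _ _
  rw [e1, key, hs]
  refine Finset.sum_congr rfl fun j _ => ?_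
  rw [inr_nprod (hne _), List.map_ofFn]
  rfl

end NProd

/-! ### Free multi-faced algebras -/

section Free

variable {α β : Type}

/-- The underlying algebra of noncommutative polynomials without constant term. -/
abbrev FreeCarrier (α : Type) : Type u := MonoidAlgebra ℂ (FreeSemigroup (ULift.{u} α))

/-- The generators of `FreeCarrier α`. -/
def freeGen (i : α) : FreeCarrier.{u} α := MonoidAlgebra.ofMagma ℂ _ (FreeSemigroup.of ⟨i⟩)

section Lift

variable {C : Type*} [NonUnitalRing C] [Module ℂ C] [IsScalarTower ℂ C C] [SMulCommClass ℂ C C]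

/-- The homomorphism determined by the images of the generators. -/
def freeLift (y : α → C) : FreeCarrier.{u} α →ₙₐ[ℂ] C :=
  MonoidAlgebra.liftMagma ℂ (FreeSemigroup.lift fun i : ULift.{u} α => y i.down)

theorem freeLift_gen (y : α → C) (i : α) : freeLift y (freeGen.{u} i) = y i := by
  simp [freeLift, freeGen]

theorem freeHom_ext {h h' : FreeCarrier.{u} α →ₙₐ[ℂ] C}
    (H : ∀ i, h (freeGen i) = h' (freeGen i)) : h = h' := by
  apply (MonoidAlgebra.liftMagma ℂ).symm.injective
  apply FreeSemigroup.hom_ext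
  funext i
  exact H i.down

end Lift

/-- The list of letters of a word. -/
def letters (w : FreeSemigroup (ULift.{u} α)) : List α := (w.head :: w.tail).map ULift.down

/-- Basis monomials are nonempty products of generators, so functionals are determined by, and may
be prescribed through, their values on nonempty words. -/
theorem ofMagma_eq_nprod (w : FreeSemigroup (ULift.{u} α)) :
    MonoidAlgebra.ofMagma ℂ _ w = nprod ((letters w).map freeGen) := by
  induction w using FreeSemigroup.recOnMul with
  | ih1 i => rfl
  | ih2 x y hx hy =>
    have e : letters (FreeSemigroup.of x * y) = letters (FreeSemigroup.of x) ++ letters y := by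
      simp [letters]
    rw [map_mul, hx, hy, e, List.map_append, nprod_append (by simp [letters]) (by simp [letters])]

/-- The functional with prescribed values on words. -/
def wordFunctional (g : List α → ℂ) : FreeCarrier.{u} α →ₗ[ℂ] ℂ :=
  (Finsupp.lift ℂ ℂ (FreeSemigroup (ULift.{u} α)) fun w => g (letters w)) ∘ₗ
    (MonoidAlgebra.coeffLinearEquiv ℂ).toLinearMap

theorem wordFunctional_nprod (g : List α → ℂ) {w : List α} (hw : w ≠ []) :
    wordFunctional g (nprod (w.map freeGen.{u})) = g w := by
  cases w with
  | nil => exact absurd rfl hw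
  | cons i w =>
    have e : letters (⟨⟨i⟩, w.map ULift.up⟩ : FreeSemigroup (ULift.{u} α)) = i :: w := by
      simp [letters, Function.comp_def]
    conv_lhs => rw [← e, ← ofMagma_eq_nprod]
    simp [wordFunctional, e]

theorem functional_ext {φ ψ : FreeCarrier.{u} α →ₗ[ℂ] ℂ}
    (H : ∀ w : List α, w ≠ [] → φ (nprod (w.map freeGen)) = ψ (nprod (w.map freeGen))) : φ = ψ := by
  refine MonoidAlgebra.lhom_ext' fun w => LinearMap.ext_ring ?_
  have e := H (letters w) (by simp [letters])
  rwa [← ofMagma_eq_nprod] at e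

/-- The multi-faced algebra freely generated by elements `i` of the faces `f i`. -/
def Free (f : α → F) : FacedAlg.{u} F where
  carrier := FreeCarrier.{u} α
  face q := NonUnitalAlgebra.adjoin ℂ {x | ∃ i, f i = q ∧ freeGen i = x}
  free := by
    intro C _ _ _ _ g
    have hm : ∀ i, freeGen.{u} i ∈ NonUnitalAlgebra.adjoin ℂ {x | ∃ i', f i' = f i ∧ freeGen i' = x} :=
      fun i => NonUnitalAlgebra.subset_adjoin ℂ ⟨i, rfl, rfl⟩
    refine ⟨freeLift fun i => g (f i) ⟨freeGen i, hm i⟩, ?_, ?_⟩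
    · rintro q ⟨x, hx⟩
      suffices H : ∃ hx' : x ∈ NonUnitalAlgebra.adjoin ℂ {x | ∃ i', f i' = q ∧ freeGen.{u} i' = x},
          freeLift (fun i => g (f i) ⟨freeGen i, hm i⟩) x = g q ⟨x, hx'⟩ from H.2
      induction hx using NonUnitalAlgebra.adjoin_induction with
      | mem y hy =>
        obtain ⟨i, rfl, rfl⟩ := hy
        exact ⟨hm i, freeLift_gen _ _⟩
      | add y z _ _ h1 h2 =>
        obtain ⟨m1, e1⟩ := h1
        obtain ⟨m2, e2⟩ := h2
        exact ⟨add_mem m1 m2, by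
          rw [map_add, e1, e2]; exact ((g q).map_add ⟨y, m1⟩ ⟨z, m2⟩).symm⟩
      | zero => exact ⟨zero_mem _, by rw [map_zero]; exact ((g q).map_zero).symm⟩
      | mul y z _ _ h1 h2 =>
        obtain ⟨m1, e1⟩ := h1
        obtain ⟨m2, e2⟩ := h2
        exact ⟨mul_mem m1 m2, by
          rw [map_mul, e1, e2]; exact ((g q).map_mul ⟨y, m1⟩ ⟨z, m2⟩).symm⟩
      | smul c y _ h1 =>
        obtain ⟨m1, e1⟩ := h1
        exact ⟨SMulMemClass.smul_mem c m1, by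
          rw [map_smul, e1]; exact ((g q).map_smul c ⟨y, m1⟩).symm⟩
    · intro h hh
      apply freeHom_ext
      intro i
      rw [freeLift_gen]
      exact hh (f i) ⟨freeGen i, hm i⟩

variable {f : α → F}

/-- The generators of `Free f`. -/
def gen (f : α → F) (i : α) : Free.{u} f := freeGen.{u} i

theorem gen_mem_face (f : α → F) (i : α) : gen.{u} f i ∈ (Free f).face (f i) :=
  NonUnitalAlgebra.subset_adjoin (A := FreeCarrier.{u} α) ℂ
    (show freeGen i ∈ {x | ∃ i', f i' = f i ∧ freeGen i' = x} from ⟨i, rfl, rfl⟩)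

/-- The word in the generators of `Free f` with the given letters. -/
def word (f : α → F) (w : List α) : Free.{u} f := nprod (w.map (gen f))

/-- The homomorphism to a multi-faced algebra determined by the images of the generators. -/
def lift (f : α → F) {A : FacedAlg.{u} F} (y : α → A) : Free.{u} f →ₙₐ[ℂ] A := freeLift y

theorem lift_gen {A : FacedAlg.{u} F} (y : α → A) (i : α) : lift f y (gen f i) = y i :=
  freeLift_gen y i

theorem lift_word {A : FacedAlg.{u} F} (y : α → A) (w : List α) :
    lift f y (word f w) = nprod (w.map y) := by
  rw [word, map_nprod, List.map_map]
  congr 2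
  funext i
  exact lift_gen y i

theorem hom_ext {A : FacedAlg.{u} F} {h h' : Free.{u} f →ₙₐ[ℂ] A}
    (H : ∀ i, h (gen f i) = h' (gen f i)) : h = h' := freeHom_ext H

theorem isFacedHom_lift {A : FacedAlg.{u} F} {y : α → A} (hy : ∀ i, y i ∈ A.face (f i)) :
    IsFacedHom (lift f y) := by
  intro q x hx
  have : (Free.{u} f).face q ≤ (A.face q).comap (lift f y) := by
    refine NonUnitalAlgebra.adjoin_le ?_
    rintro _ ⟨i, rfl, rfl⟩
    change lift f y (gen f i) ∈ A.face (f i)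
    rw [lift_gen]
    exact hy i
  exact this hx

/-- The functional on `Free f` with prescribed values on words. -/
def ofWords (f : α → F) (g : List α → ℂ) : (Free.{u} f).Functional := wordFunctional g

theorem ofWords_word (g : List α → ℂ) {w : List α} (hw : w ≠ []) :
    ofWords f g (word f w) = g w := wordFunctional_nprod g hw

theorem ext_word {φ ψ : (Free.{u} f).Functional}
    (H : ∀ w : List α, w ≠ [] → φ (word f w) = ψ (word f w)) : φ = ψ := functional_ext H

end Free

/-! ### Convolution of functionals on free multi-faced algebras -/

theorem FacedAlg.inl_mem_face {A B : FacedAlg.{u} F} {q : F} {x : A} (hx : x ∈ A.face q) :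
    FacedAlg.inl A B x ∈ (A.coprod B).face q :=
  le_sup_left (α := NonUnitalSubalgebra ℂ (FreeProd A B))
    (a := (A.face q).map (FreeProd.inl : A →ₙₐ[ℂ] FreeProd A B)) ⟨x, hx, rfl⟩

theorem FacedAlg.inr_mem_face {A B : FacedAlg.{u} F} {q : F} {x : B} (hx : x ∈ B.face q) :
    FacedAlg.inr A B x ∈ (A.coprod B).face q :=
  le_sup_right (α := NonUnitalSubalgebra ℂ (FreeProd A B))
    (b := (B.face q).map (FreeProd.inr : B →ₙₐ[ℂ] FreeProd A B)) ⟨x, hx, rfl⟩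

/-- The functional `φ ∘ h`. -/
def pull {A B : FacedAlg.{u} F} (φ : A.Functional) (h : B →ₙₐ[ℂ] A) : B.Functional :=
  φ ∘ₗ (h : B →ₗ[ℂ] A)

theorem pull_apply {A B : FacedAlg.{u} F} (φ : A.Functional) (h : B →ₙₐ[ℂ] A) (x : B) :
    pull φ h x = φ (h x) := rfl

theorem pull_pull {A B C : FacedAlg.{u} F} (φ : A.Functional) (h : B →ₙₐ[ℂ] A)
    (h' : C →ₙₐ[ℂ] B) : pull (pull φ h) h' = pull φ (h.comp h') := rfl

section Conv

variable {α β : Type} {f : α → F} {g : β → F} (P : UniversalProduct.{u} F)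

theorem op_pull {A₁ A₂ B₁ B₂ : FacedAlg.{u} F} (φ₁ : A₁.Functional) (φ₂ : A₂.Functional)
    {h₁ : B₁ →ₙₐ[ℂ] A₁} {h₂ : B₂ →ₙₐ[ℂ] A₂} (H₁ : IsFacedHom h₁) (H₂ : IsFacedHom h₂) :
    P.op (pull φ₁ h₁) (pull φ₂ h₂) = pull (P.op φ₁ φ₂) (FacedAlg.map h₁ h₂) :=
  P.universal φ₁ φ₂ h₁ h₂ H₁ H₂

/-- The homomorphism `x ↦ x + x'` from a free multi-faced algebra to its free square. -/
def diag (f : α → F) : Free.{u} f →ₙₐ[ℂ] (Free.{u} f).coprod (Free.{u} f) :=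
  lift f fun i => FacedAlg.inl _ _ (gen f i) + FacedAlg.inr _ _ (gen f i)

theorem isFacedHom_diag : IsFacedHom (diag.{u} f) :=
  isFacedHom_lift fun i => add_mem (FacedAlg.inl_mem_face (gen_mem_face f i))
    (FacedAlg.inr_mem_face (gen_mem_face f i))

/-- The convolution of two functionals on a free multi-faced algebra. -/
def conv (φ ψ : (Free.{u} f).Functional) : (Free.{u} f).Functional :=
  pull (P.op φ ψ) (diag f)

theorem isFacedHom_id (A : FacedAlg.{u} F) : IsFacedHom (NonUnitalAlgHom.id ℂ A) :=
  fun _ _ hx => hx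

/-- By universality the left side is `P.op φ ψ` composed with `(h₁ ⊔ h₂) ∘ diag`, and that
homomorphism is determined by its values `h₁ x + h₂ x` on generators. The monoid laws and the
passage to iterated products are instances. -/
theorem conv_pull {A B : FacedAlg.{u} F} (φ : A.Functional) (ψ : B.Functional)
    {h₁ : Free.{u} f →ₙₐ[ℂ] A} {h₂ : Free.{u} f →ₙₐ[ℂ] B}
    (H₁ : IsFacedHom h₁) (H₂ : IsFacedHom h₂) :
    conv P (pull φ h₁) (pull ψ h₂) = pull (P.op φ ψ)
      (lift f fun i => FacedAlg.inl A B (h₁ (gen f i)) + FacedAlg.inr A B (h₂ (gen f i))) := by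
  rw [conv, op_pull P φ ψ H₁ H₂, pull_pull]
  congr 1
  apply hom_ext
  intro i
  rw [NonUnitalAlgHom.comp_apply, diag, lift_gen, lift_gen, map_add]
  erw [FacedAlg.desc_inl, FacedAlg.desc_inr]
  rfl

/-- Both sides are the triple product evaluated along `x ↦ x + x' + x''`. -/
theorem conv_assoc (φ ψ χ : (Free.{u} f).Functional) :
    conv P (conv P φ ψ) χ = conv P φ (conv P ψ χ) := by
  have e1 := conv_pull P (P.op φ ψ) χ (isFacedHom_diag (f := f)) (isFacedHom_id _)
  have e2 := conv_pull P φ (P.op ψ χ) (isFacedHom_id _) (isFacedHom_diag (f := f))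
  have e3 : P.op (P.op φ ψ) χ = pull (P.op φ (P.op ψ χ)) (FacedAlg.assoc _ _ _) :=
    LinearMap.ext fun x => P.associative φ ψ χ x
  refine e1.trans (Eq.trans ?_ e2.symm)
  rw [e3, pull_pull]
  congr 1
  apply hom_ext
  intro i
  rw [NonUnitalAlgHom.comp_apply, lift_gen, lift_gen, map_add, diag, lift_gen, map_add, map_add,
    FacedAlg.assoc]
  simp only [FacedAlg.desc_inl, FacedAlg.desc_inr, NonUnitalAlgHom.comp_apply,
    map_add, add_assoc]
  rfl

theorem conv_comm (hP : P.IsSymmetric) (φ ψ : (Free.{u} f).Functional) :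
    conv P φ ψ = conv P ψ φ := by
  have e : P.op φ ψ = pull (P.op ψ φ) (FacedAlg.swap _ _) := LinearMap.ext fun x => hP φ ψ x
  rw [conv, conv, e, pull_pull]
  congr 1
  apply hom_ext
  intro i
  rw [NonUnitalAlgHom.comp_apply, diag, lift_gen, map_add, FacedAlg.swap,
    FacedAlg.desc_inl, FacedAlg.desc_inr, add_comm]

/-- The zero functional factors through the zero homomorphism, so the diagonal collapses to the
first inclusion, along which the product restricts to `φ`. -/
theorem conv_zero (φ : (Free.{u} f).Functional) : conv P φ 0 = φ := by
  have h0 : IsFacedHom (0 : Free.{u} f →ₙₐ[ℂ] Free.{u} f) := fun q x _ => zero_mem _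
  have e := conv_pull P φ 0 (isFacedHom_id (Free.{u} f)) h0
  have e' : pull (0 : (Free.{u} f).Functional) (0 : Free.{u} f →ₙₐ[ℂ] Free.{u} f) = 0 := rfl
  rw [e'] at e
  refine Eq.trans (b := conv P (pull φ (NonUnitalAlgHom.id ℂ _)) 0) rfl (e.trans ?_)
  have e2 : (lift f fun i => FacedAlg.inl (Free.{u} f) (Free.{u} f) ((NonUnitalAlgHom.id ℂ _) (gen f i)) +
      FacedAlg.inr (Free.{u} f) (Free.{u} f) ((0 : Free.{u} f →ₙₐ[ℂ] Free.{u} f) (gen f i))) =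
      FacedAlg.inl _ _ := by
    apply hom_ext
    intro i
    rw [lift_gen, NonUnitalAlgHom.zero_apply, map_zero, add_zero]
    rfl
  rw [e2]
  exact LinearMap.ext fun x => P.restrict_left φ 0 x

/-- Functionals on a free multi-faced algebra, with convolution as multiplication. -/
def Conv (_ : UniversalProduct.{u} F) (f : α → F) : Type u := (Free.{u} f).Functional

/-- A functional, as an element of the convolution monoid. -/
def toConv : (Free.{u} f).Functional ≃ Conv P f := Equiv.refl _

variable [hP : Fact P.IsSymmetric]

instance : CommMonoid (Conv P f) where
  mul := conv P
  one := (0 : (Free.{u} f).Functional)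
  mul_assoc := conv_assoc P
  mul_comm := conv_comm P hP.out
  mul_one := conv_zero P
  one_mul φ := (conv_comm P hP.out _ _).trans (conv_zero P φ)

/-- The convolution of a finite family of functionals. -/
def convProd {ι : Type*} (s : Finset ι) (φ : ι → (Free.{u} f).Functional) :
    (Free.{u} f).Functional :=
  (toConv P).symm (∏ i ∈ s, toConv P (φ i))

theorem convProd_univ_one (φ : Fin 1 → (Free.{u} f).Functional) :
    convProd P Finset.univ φ = φ 0 := by
  rw [convProd, Fin.prod_univ_one, Equiv.symm_apply_apply]

theorem convProd_univ_succ {k : ℕ} (φ : Fin (k + 2) → (Free.{u} f).Functional) :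
    convProd P Finset.univ φ = conv P (φ 0) (convProd P Finset.univ fun i : Fin (k + 1) => φ i.succ) := by
  rw [convProd, Fin.prod_univ_succ]
  rfl

/-- The elements `y` of the face `q` such that `diag y = y + y'`. -/
def primitive (g : β → F) (q : F) : Submodule ℂ (Free.{u} g) where
  carrier := {y | y ∈ (Free.{u} g).face q ∧
    diag g y = FacedAlg.inl _ _ y + FacedAlg.inr _ _ y}
  add_mem' := by
    rintro x y ⟨h1, h2⟩ ⟨h3, h4⟩
    refine ⟨add_mem h1 h3, ?_⟩
    rw [map_add, map_add, map_add, h2, h4]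
    abel
  zero_mem' := ⟨zero_mem _, by rw [map_zero, map_zero, map_zero, add_zero]⟩
  smul_mem' := by
    rintro c x ⟨h1, h2⟩
    refine ⟨SMulMemClass.smul_mem c h1, ?_⟩
    rw [map_smul, map_smul, map_smul, h2, smul_add]

theorem gen_mem_primitive (g : β → F) (i : β) : gen.{u} g i ∈ primitive g (g i) :=
  ⟨gen_mem_face g i, by rw [diag, lift_gen]⟩

/-- A substitution with primitive values intertwines the diagonals, so pulling back is a
homomorphism of convolution monoids. Since `primitive` is a linear subspace, this covers renaming,
deleting, scaling and averaging letters, the only operations used below. -/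
theorem pull_conv {y : α → Free.{u} g} (hy : ∀ i, y i ∈ primitive g (f i))
    (φ ψ : (Free.{u} g).Functional) :
    pull (conv P φ ψ) (lift f y) = conv P (pull φ (lift f y)) (pull ψ (lift f y)) := by
  have hf : IsFacedHom (lift f y) := isFacedHom_lift fun i => (hy i).1
  rw [conv_pull P φ ψ hf hf, conv, pull_pull]
  congr 1
  apply hom_ext
  intro i
  rw [NonUnitalAlgHom.comp_apply, lift_gen, lift_gen, (hy i).2, lift_gen]

theorem pull_convProd {y : α → Free.{u} g} (hy : ∀ i, y i ∈ primitive g (f i))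
    {ι : Type*} (s : Finset ι) (φ : ι → (Free.{u} g).Functional) :
    pull (convProd P s φ) (lift f y) = convProd P s fun i => pull (φ i) (lift f y) := by
  let m : Conv P g →* Conv P f :=
    { toFun := fun φ => pull φ (lift f y)
      map_one' := rfl
      map_mul' := pull_conv P hy }
  exact map_prod m (fun i => toConv P (φ i)) s

/-! ### Iterated products -/

theorem FacedAlg.incl_mem_face {q : F} : ∀ {k : ℕ} {A : Fin (k + 1) → FacedAlg.{u} F}
    (κ : Fin (k + 1)) {x : A κ}, x ∈ (A κ).face q → FacedAlg.incl A κ x ∈ (FacedAlg.iter A).face q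
  | 0, A, κ, x, hx => by
    obtain rfl : κ = 0 := Fin.fin_one_eq_zero κ
    exact hx
  | k + 1, A, κ, x, hx => by
    cases κ using Fin.cases with
    | zero => exact FacedAlg.inl_mem_face hx
    | succ i =>
      exact FacedAlg.inr_mem_face (FacedAlg.incl_mem_face (A := fun i => A i.succ) i hx)

/-- This places the iterated product inside the convolution monoid: choosing `e κ i` to be `a_i`
when leg `i` has label `κ` and `0` otherwise makes the right side a mixed moment. -/
theorem convProd_pull_lift : ∀ {k : ℕ} {A : Fin (k + 1) → FacedAlg.{u} F}
    (φ : ∀ κ, (A κ).Functional) {e : ∀ κ, α → A κ} (_ : ∀ κ i, e κ i ∈ (A κ).face (f i)),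
    convProd P Finset.univ (fun κ => pull (φ κ) (lift f (e κ))) =
      pull (P.iter A φ) (lift f fun i => ∑ κ, FacedAlg.incl A κ (e κ i))
  | 0, A, φ, e, he => by
    rw [convProd_univ_one]
    change pull (φ 0) _ = pull (φ 0) _
    congr 2
    funext i
    rw [Fin.sum_univ_one]
    rfl
  | k + 1, A, φ, e, he => by
    rw [convProd_univ_succ, convProd_pull_lift (A := fun i => A i.succ) (fun i => φ i.succ)
      (e := fun i => e i.succ) (fun i => he i.succ)]
    refine (conv_pull P (φ 0) (P.iter (fun i => A i.succ) fun i => φ i.succ)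
      (isFacedHom_lift (he 0)) (isFacedHom_lift fun i =>
        sum_mem fun κ _ => FacedAlg.incl_mem_face κ (he κ.succ i))).trans ?_
    change pull (P.iter A φ) _ = _
    congr 2
    funext i
    rw [lift_gen, lift_gen, map_sum]
    exact (Fin.sum_univ_succ (M := FacedAlg.iter A) fun κ => FacedAlg.incl A κ (e κ i)).symm

end Conv

/-! ### Dependence of a convolution on the values at words without repeated letters -/

section Nodup

variable {α β : Type} {f : α → F} {g : β → F}

theorem nprod_ofFn_smul {R : Type*} [NonUnitalRing R] [Module ℂ R] [IsScalarTower ℂ R R]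
    [SMulCommClass ℂ R R] {n : ℕ} (hn : n ≠ 0) (c : ℂ) (x : Fin n → R) :
    nprod (List.ofFn fun i => c • x i) = c ^ n • nprod (List.ofFn x) := by
  have hne : List.finRange n ≠ [] := by simpa using hn
  rw [List.ofFn_eq_map, List.ofFn_eq_map, nprod_map_smul hne (fun _ => c) x]
  simp

theorem lift_gen_word (v : α → β) (w : List α) :
    lift f (fun i => gen.{u} g (v i)) (word f w) = word g (w.map v) := by
  rw [lift_word, word, List.map_map]
  rfl

/-- The functionals agree on all words without repeated letters. -/
def AgreeOnNodup (φ φ' : (Free.{u} f).Functional) : Prop :=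
  ∀ w : List α, w ≠ [] → w.Nodup → φ (word f w) = φ' (word f w)

theorem AgreeOnNodup.pull_lift {φ φ' : (Free.{u} g).Functional} (h : AgreeOnNodup φ φ')
    {v : α → β} (hv : Function.Injective v) :
    AgreeOnNodup (pull φ (lift f fun i => gen g (v i))) (pull φ' (lift f fun i => gen g (v i))) := by
  intro w hw hn
  rw [pull_apply, pull_apply, lift_gen_word]
  exact h _ (by simpa using hw) (hn.map hv)

/-- The sign of the second component of a pair. -/
def pairSign : Option (α × Bool) → ℂ
  | some (_, true) => 1
  | some (_, false) => -1
  | none => 0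

theorem pairSign_mul_self (x : α × Bool) : pairSign (some x) * pairSign (some x) = 1 := by
  rcases x with ⟨i, _ | _⟩ <;> simp [pairSign]

/-- Flipping the choice at position `p` is an involution which negates every summand, because `q ≠
p` is untouched. -/
theorem sum_pairSign {m : ℕ} (w : Fin m → α) {p q : Fin m} (hpq : p ≠ q) :
    ∑ j : Fin m → Bool, pairSign (some (w p, j p)) * pairSign (some (w q, j q)) = 0 := by
  have hinv : Function.Involutive fun j : Fin m → Bool => Function.update j p (!j p) := by
    intro j
    ext r
    by_cases hr : r = p
    · subst hr; simp
    · simp [hr]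
  let E : Equiv.Perm (Fin m → Bool) := Function.Involutive.toPerm _ hinv
  have h := Equiv.sum_comp E
    fun j : Fin m → Bool => pairSign (some (w p, j p)) * pairSign (some (w q, j q))
  have e : ∀ j : Fin m → Bool,
      pairSign (some (w p, E j p)) * pairSign (some (w q, E j q)) =
        -(pairSign (some (w p, j p)) * pairSign (some (w q, j q))) := by
    intro j
    have h1 : E j p = !j p := by simp [E, Function.Involutive.toPerm]
    have h2 : E j q = j q := by simp [E, Function.Involutive.toPerm, hpq.symm]
    rw [h1, h2]
    cases j p <;> simp [pairSign]
  rw [Finset.sum_congr rfl fun j _ => e j, Finset.sum_neg_distrib] at h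
  exact self_eq_neg.1 h.symm

/-- Two functionals which agree on words without repeated letters are the restrictions of one
functional in doubled letters along the choices of one copy of each letter and along the average
of both copies. -/
theorem AgreeOnNodup.exists_double {φ φ' : (Free.{u} f).Functional} (h : AgreeOnNodup φ φ') :
    ∃ Γ : (Free.{u} (fun x : α × Bool => f x.1)).Functional,
      (∀ j : α → Bool, pull Γ (lift f fun i => gen _ (i, j i)) = φ) ∧
      pull Γ (lift f fun i => ∑ s, (2⁻¹ : ℂ) • gen _ (i, s)) = φ' := by
  have hpq : ∀ w : List α, ∃ p q : ℕ, ¬ w.Nodup → p < q ∧ q < w.length ∧ w[p]? = w[q]? := by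
    intro w
    by_cases hw : w.Nodup
    · exact ⟨0, 0, fun h => absurd hw h⟩
    · have hw' := hw
      rw [List.nodup_iff_getElem?_ne_getElem?] at hw'
      push Not at hw'
      obtain ⟨p, q, h1, h2, h3⟩ := hw'
      exact ⟨p, q, fun _ => ⟨h1, h2, h3⟩⟩
  choose p q hpq using hpq
  let Γ : (Free.{u} (fun x : α × Bool => f x.1)).Functional := ofWords _ fun v =>
    φ (word f (v.map Prod.fst)) +
      (φ' (word f (v.map Prod.fst)) - φ (word f (v.map Prod.fst))) *
        (1 - pairSign v[p (v.map Prod.fst)]? * pairSign v[q (v.map Prod.fst)]?)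
  refine ⟨Γ, fun j => ext_word fun w hw => ?_, ext_word fun w hw => ?_⟩
  · have e : (w.map fun i => (i, j i)).map Prod.fst = w := by simp [Function.comp_def]
    rw [pull_apply, lift_gen_word (fun i => (i, j i)), ofWords_word _ (by simpa using hw), e]
    by_cases hn : w.Nodup
    · rw [h w hw hn]; ring
    · obtain ⟨h1, h2, h3⟩ := hpq w hn
      rw [List.getElem?_map, List.getElem?_map, h3, List.getElem?_eq_getElem h2, Option.map_some,
        pairSign_mul_self]
      ring
  · have hlen : w.length ≠ 0 := by simpa using hw
    rw [pull_apply, lift_word]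
    have e : (w.map fun i => ∑ s, (2⁻¹ : ℂ) • gen.{u} (fun x : α × Bool => f x.1) (i, s)) =
        List.ofFn fun r : Fin w.length =>
          ∑ s, (2⁻¹ : ℂ) • gen.{u} (fun x : α × Bool => f x.1) (w[r], s) := by
      apply List.ext_getElem <;> simp
    rw [e, nprod_ofFn_sum hlen, map_sum]
    have e2 : ∀ j : Fin w.length → Bool,
        Γ (nprod (List.ofFn fun r => (2⁻¹ : ℂ) • gen.{u} (fun x : α × Bool => f x.1) (w[r], j r))) =
          2⁻¹ ^ w.length * (φ (word f w) + (φ' (word f w) - φ (word f w)) *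
            (1 - pairSign (List.ofFn fun r => (w[r], j r))[p w]? *
              pairSign (List.ofFn fun r => (w[r], j r))[q w]?)) := by
      intro j
      have e3 : (List.ofFn fun r : Fin w.length => gen.{u} (fun x : α × Bool => f x.1) (w[r], j r)) =
          (List.ofFn fun r : Fin w.length => (w[r], j r)).map (gen _) := by
        rw [List.map_ofFn]; rfl
      have e4 : (List.ofFn fun r : Fin w.length => (w[r], j r)).map Prod.fst = w := by
        rw [List.map_ofFn]
        apply List.ext_getElem <;> simp
      rw [nprod_ofFn_smul hlen, map_smul, smul_eq_mul, e3, ← word,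
        ofWords_word _ (by simpa using hlen), e4]
    rw [Finset.sum_congr rfl fun j _ => e2 j, ← Finset.mul_sum, Finset.sum_add_distrib,
      ← Finset.mul_sum, Finset.sum_sub_distrib]
    have hc : (2⁻¹ : ℂ) ^ w.length * 2 ^ w.length = 1 := by
      rw [← mul_pow]; norm_num
    by_cases hn : w.Nodup
    · rw [h w hw hn]
      simp only [sub_self, zero_mul, add_zero, Finset.sum_const, Finset.card_univ,
        Fintype.card_fun, Fintype.card_bool, Fintype.card_fin, nsmul_eq_mul]
      push_cast
      rw [← mul_assoc, hc, one_mul]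
    · obtain ⟨h1, h2, h3⟩ := hpq w hn
      have h4 := sum_pairSign (fun r : Fin w.length => w[r])
        (p := ⟨p w, h1.trans h2⟩) (q := ⟨q w, h2⟩) (by simpa using h1.ne)
      have e5 : ∀ j : Fin w.length → Bool,
          pairSign (List.ofFn fun r => (w[r], j r))[p w]? *
              pairSign (List.ofFn fun r => (w[r], j r))[q w]? =
          pairSign (some (w[p w]'(h1.trans h2), j ⟨p w, h1.trans h2⟩)) *
            pairSign (some (w[q w]'h2, j ⟨q w, h2⟩)) := by
        intro j
        rw [List.getElem?_eq_getElem (by simpa using h1.trans h2),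
          List.getElem?_eq_getElem (by simpa using h2)]
        simp
      rw [Finset.sum_congr rfl fun j _ => e5 j]
      erw [h4]
      simp only [sub_zero, Finset.sum_const, Finset.card_univ,
        Fintype.card_fun, Fintype.card_bool, Fintype.card_fin, nsmul_eq_mul]
      push_cast
      linear_combination φ' (word f w) * hc

variable (P : UniversalProduct.{u} F) [hP : Fact P.IsSymmetric]

/-- Replacing each letter by the average of its two copies turns `Γ` into `φ'`. Expanding
multilinearly, each term picks one copy of each letter, because every letter occurs exactly once in
the word; under such a choice `Γ` becomes `φ`. Hence the value for `φ'` is an average of copies of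
the value for `φ`. -/
theorem conv_congr_finRange {n : ℕ} (hn : n ≠ 0) {f : Fin n → F}
    {φ φ' : (Free.{u} f).Functional} (h : AgreeOnNodup φ φ') (ψ : (Free.{u} f).Functional) :
    conv P φ ψ (word f (List.finRange n)) = conv P φ' ψ (word f (List.finRange n)) := by
  obtain ⟨Γ, h1, h2⟩ := h.exists_double
  -- Identifying the two copies gives an extension of `ψ` which returns `ψ` both under choices and
  -- under averaging.
  let Ψ : (Free.{u} (fun x : Fin n × Bool => f x.1)).Functional :=
    pull ψ (lift _ fun x => gen f x.1)
  have h3 : ∀ j : Fin n → Bool, pull Ψ (lift f fun i => gen _ (i, j i)) = ψ := by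
    intro j
    rw [pull_pull]
    refine Eq.trans (congrArg (pull ψ) (hom_ext (h' := NonUnitalAlgHom.id ℂ _) fun i => ?_)) rfl
    rw [NonUnitalAlgHom.comp_apply, lift_gen, lift_gen]
    rfl
  have h4 : pull Ψ (lift f fun i => ∑ s, (2⁻¹ : ℂ) • gen _ (i, s)) = ψ := by
    rw [pull_pull]
    refine Eq.trans (congrArg (pull ψ) (hom_ext (h' := NonUnitalAlgHom.id ℂ _) fun i => ?_)) rfl
    rw [NonUnitalAlgHom.comp_apply, lift_gen, map_sum]
    simp only [map_smul, lift_gen]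
    rw [Finset.sum_const, Finset.card_univ, Fintype.card_bool, ← smul_assoc]
    norm_num
  have hy : ∀ i, ∑ s, (2⁻¹ : ℂ) • gen _ (i, s) ∈
      primitive.{u} (fun x : Fin n × Bool => f x.1) (f i) :=
    fun i => sum_mem fun s _ => Submodule.smul_mem _ _ (gen_mem_primitive _ (i, s))
  have h5 : conv P φ' ψ = pull (conv P Γ Ψ) (lift f fun i => ∑ s, (2⁻¹ : ℂ) • gen _ (i, s)) := by
    rw [pull_conv P hy, h2, h4]
  have h6 : ∀ j : Fin n → Bool,
      conv P φ ψ = pull (conv P Γ Ψ) (lift f fun i => gen _ (i, j i)) := by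
    intro j
    have hy' : ∀ i, gen _ (i, j i) ∈ primitive.{u} (fun x : Fin n × Bool => f x.1) (f i) :=
      fun i => gen_mem_primitive _ (i, j i)
    rw [pull_conv P hy', h1, h3]
  rw [h5, pull_apply, lift_word, ← List.ofFn_eq_map, nprod_ofFn_sum hn, map_sum]
  have e : ∀ j : Fin n → Bool,
      conv P Γ Ψ (nprod (List.ofFn fun i => (2⁻¹ : ℂ) • gen _ (i, j i))) =
        2⁻¹ ^ n * conv P φ ψ (word f (List.finRange n)) := by
    intro j
    rw [h6 j, pull_apply, lift_word, ← List.ofFn_eq_map, nprod_ofFn_smul hn, map_smul, smul_eq_mul]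
  rw [Finset.sum_congr rfl fun j _ => e j, Finset.sum_const, Finset.card_univ, Fintype.card_fun,
    Fintype.card_bool, Fintype.card_fin, nsmul_eq_mul, ← mul_assoc]
  push_cast
  rw [← mul_pow]
  norm_num

/-- A word without repetition is the image of the full word in its own letters under an injective
renaming. -/
theorem AgreeOnNodup.conv_left {φ φ' : (Free.{u} f).Functional} (h : AgreeOnNodup φ φ')
    (ψ : (Free.{u} f).Functional) : AgreeOnNodup (conv P φ ψ) (conv P φ' ψ) := by
  intro w hw hn
  have hv : Function.Injective w.get := List.nodup_iff_injective_get.1 hn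
  have e : word.{u} f w = lift (fun i => f (w.get i)) (fun i => gen f (w.get i))
      (word _ (List.finRange w.length)) := by
    rw [lift_gen_word, ← List.ofFn_eq_map, List.ofFn_get]
  have hy : ∀ i, gen f (w.get i) ∈ primitive.{u} f (f (w.get i)) :=
    fun i => gen_mem_primitive f (w.get i)
  rw [e, ← pull_apply, ← pull_apply, pull_conv P hy, pull_conv P hy]
  exact conv_congr_finRange P (by simpa using hw) (h.pull_lift hv) _

/-- By `AgreeOnNodup.conv_left` and commutativity, agreement is a congruence on the convolution
monoid. -/
theorem AgreeOnNodup.convProd {ι : Type*} {s : Finset ι} {φ φ' : ι → (Free.{u} f).Functional}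
    (h : ∀ i ∈ s, AgreeOnNodup (φ i) (φ' i)) :
    AgreeOnNodup (convProd P s φ) (convProd P s φ') := by
  let c : Con (Conv P f) :=
    { r := fun φ φ' => AgreeOnNodup ((toConv P).symm φ) ((toConv P).symm φ')
      iseqv := ⟨fun φ w _ _ => rfl, fun h w hw hn => (h w hw hn).symm,
        fun h h' w hw hn => (h w hw hn).trans (h' w hw hn)⟩
      mul' := by
        intro a b c d h h' w hw hn
        refine (h.conv_left P ((toConv P).symm c) w hw hn).trans ?_
        rw [conv_comm P hP.out]
        refine (h'.conv_left P _ w hw hn).trans ?_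
        rw [conv_comm P hP.out]
        rfl }
  exact Con.finsetProd c s h

end Nodup

/-! ### Convolutions of functionals supported on single words -/

section Core

theorem mixedPartial_prod_mul : ∀ (k : ℕ) (C : ℂ), mixedPartial k (fun t => (∏ κ, t κ) * C) = C
  | 0, C => by simp [mixedPartial]
  | k + 1, C => by
    have e : (fun t : ℂ => mixedPartial k fun s =>
        (∏ κ, (Fin.cons t s : Fin (k + 1) → ℂ) κ) * C) = fun t => t * C := by
      funext t
      rw [← mixedPartial_prod_mul k (t * C)]
      congr 1
      funext s
      rw [Fin.prod_univ_succ]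
      simp only [Fin.cons_zero, Fin.cons_succ]
      ring
    rw [mixedPartial, e]
    simp

/-- The partition into the nonempty fibres of a map. -/
def kerPartition {n : ℕ} {S : Type*} (j : Fin n → S) : LegPartition n :=
  Finpartition.ofSetoid (Setoid.ker j)

theorem kerPartition_parts {n : ℕ} {S : Type*} (j : Fin n → S) :
    (kerPartition j).parts =
      (Finset.univ.image j).image fun s => Finset.univ.filter fun i => j i = s := by
  have hp : ∀ i, (kerPartition j).part i = Finset.univ.filter fun i' => j i' = j i := by
    intro i
    ext i'
    rw [Finset.mem_filter, and_iff_right (Finset.mem_univ _), kerPartition,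
      Finpartition.mem_part_ofSetoid_iff_rel, Setoid.ker_def]
    exact eq_comm
  ext β
  rw [Finset.image_image, Finset.mem_image]
  constructor
  · intro hβ
    obtain ⟨i, hi⟩ := Finpartition.nonempty_of_mem_parts _ hβ
    refine ⟨i, Finset.mem_univ _, ?_⟩
    rw [Function.comp_apply, ← hp, Finpartition.part_eq_of_mem _ hβ hi]
  · rintro ⟨i, -, rfl⟩
    rw [Function.comp_apply, ← hp]
    exact (Finpartition.part_mem _).2 (Finset.mem_univ i)

variable {n : ℕ} {f : Fin n → F}

/-- The projection onto the generators satisfying `c`. -/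
def mask (f : Fin n → F) (c : Fin n → Prop) : Free.{u} f →ₙₐ[ℂ] Free.{u} f :=
  lift f fun i => if c i then gen f i else 0

theorem mask_mem_primitive (c : Fin n → Prop) (i : Fin n) :
    (if c i then gen.{u} f i else 0) ∈ primitive f (f i) := by
  split_ifs
  · exact gen_mem_primitive f i
  · exact zero_mem _

theorem mask_word_of_forall {c : Fin n → Prop} {w : List (Fin n)} (h : ∀ i ∈ w, c i) :
    mask f c (word.{u} f w) = word f w := by
  rw [mask, lift_word, word]
  congr 1
  exact List.map_congr_left fun i hi => if_pos (h i hi)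

theorem mask_word_of_exists {c : Fin n → Prop} {w : List (Fin n)} (h : ∃ i ∈ w, ¬ c i) :
    mask f c (word.{u} f w) = 0 := by
  rw [mask, lift_word]
  obtain ⟨i, hi, hc⟩ := h
  exact nprod_eq_zero (List.mem_map.2 ⟨i, hi, if_neg hc⟩)

/-- The homomorphism which multiplies the generators by scalars. -/
def scale (f : Fin n → F) (c : Fin n → ℂ) : Free.{u} f →ₙₐ[ℂ] Free.{u} f :=
  lift f fun i => c i • gen f i

theorem scale_mem_primitive (c : Fin n → ℂ) (i : Fin n) :
    c i • gen.{u} f i ∈ primitive f (f i) :=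
  Submodule.smul_mem _ _ (gen_mem_primitive f i)

theorem scale_word (c : Fin n → ℂ) {w : List (Fin n)} (hw : w ≠ []) :
    scale f c (word.{u} f w) = (w.map c).prod • word f w := by
  rw [scale, lift_word, nprod_map_smul hw c, word]

/-- The functional vanishes on all words except possibly one word without repeated letters. -/
def IsSingle (ψ : (Free.{u} f).Functional) : Prop :=
  ∃ w : List (Fin n), w.Nodup ∧ ∀ v : List (Fin n), v ≠ [] → v ≠ w → ψ (word f v) = 0

theorem prod_ite_eq_of_nodup {w : List (Fin n)} (hw : w.Nodup) {y : Fin n} (hy : y ∈ w) (t : ℂ) :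
    (w.map fun i => if i = y then t else 1).prod = t := by
  rw [← List.prod_toFinset _ hw, Finset.prod_ite_eq', if_pos (List.mem_toFinset.2 hy)]

variable (P : UniversalProduct.{u} F) [hP : Fact P.IsSymmetric]

/-- Masking lets each letter survive only in the copy of the free algebra with its own label, which
gives exactly the argument in the definition of highest coefficients. -/
theorem convProd_mask_eq_iter {k : ℕ} (b : Fin n → Fin (k + 1))
    (χ : Fin (k + 1) → (Free.{u} f).Functional) :
    convProd P Finset.univ (fun κ => pull (χ κ) (mask f fun i => b i = κ))
        (word f (List.finRange n)) =
      P.iter (fun _ => Free f) χ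
        (nprod (List.ofFn fun i => FacedAlg.incl (fun _ => Free f) (b i) (gen f i))) := by
  have hg : ∀ (c : Fin n → Prop) (i : Fin n),
      mask f c (gen.{u} f i) = if c i then gen f i else 0 := fun c i => lift_gen _ i
  have he : ∀ (κ : Fin (k + 1)) (i : Fin n),
      mask f (fun i => b i = κ) (gen.{u} f i) ∈ (Free f).face (f i) := by
    intro κ i
    rw [hg]
    exact (mask_mem_primitive (fun i => b i = κ) i).1
  have h := convProd_pull_lift P (A := fun _ => Free.{u} f) χ he
  have hm : ∀ κ, lift f (fun i => mask f (fun i => b i = κ) (gen.{u} f i)) =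
      mask f fun i => b i = κ := fun κ => hom_ext fun i => lift_gen _ i
  simp only [hm] at h
  rw [h, pull_apply, lift_word, ← List.ofFn_eq_map]
  congr 3
  funext i
  rw [Finset.sum_eq_single (b i), hg, if_pos rfl]
  · intro κ _ hκ
    rw [hg, if_neg (Ne.symm hκ), map_zero]
  · exact fun h => absurd (Finset.mem_univ _) h

variable {w₀ : ∀ m : ℕ, (Fin m → F) → LegPartition m → ℂ}

/-- Scaling letters scales each masked functional, since its support is at most one word without
repetition. If each functional can be scaled by its own `t κ` in this way, the iterated product is
exactly `(∏ t κ)` times a constant, so the mixed derivative returns that constant. -/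
theorem convProd_mask_of_surjective (hH : P.HasHighestCoefficients w₀) {k : ℕ}
    {b : Fin n → Fin (k + 1)} (hb : Function.Surjective b)
    {ψ : Fin (k + 1) → (Free.{u} f).Functional} (hψ : ∀ κ, IsSingle (ψ κ)) :
    convProd P Finset.univ (fun κ => pull (ψ κ) (mask f fun i => b i = κ))
        (word f (List.finRange n)) =
      w₀ n f (kerPartition b) *
        ∏ κ, ψ κ (word f ((Finset.univ.filter fun i => b i = κ).sort (· ≤ ·))) := by
  choose w hwn hw using hψ
  have hne : List.finRange n ≠ [] := by
    obtain ⟨i, -⟩ := hb 0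
    exact List.ne_nil_of_mem (List.mem_finRange i)
  by_cases hc : ∃ y, y ∉ w (b y)
  -- Here no masked functional sees the letter `y`, so deleting `y` changes none of them but kills
  -- the word. On the right the block containing `y` differs from the supporting word, so both sides
  -- vanish.
  · obtain ⟨y, hy⟩ := hc
    have hs : ∀ κ, pull (pull (ψ κ) (mask f fun i => b i = κ))
        (scale f fun i => if i = y then (0 : ℂ) else 1) = pull (ψ κ) (mask f fun i => b i = κ) := by
      intro κ
      refine ext_word fun v hv => ?_
      rw [pull_apply, scale_word _ hv, map_smul, smul_eq_mul]
      by_cases hyv : y ∈ v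
      · have h0 : pull (ψ κ) (mask f fun i => b i = κ) (word f v) = 0 := by
          rw [pull_apply]
          by_cases hvκ : ∀ i ∈ v, b i = κ
          · rw [mask_word_of_forall hvκ]
            refine hw κ v hv ?_
            rintro rfl
            exact hy (by rw [hvκ y hyv]; exact hyv)
          · push Not at hvκ
            rw [mask_word_of_exists hvκ, map_zero]
        rw [h0, mul_zero]
      · have h1 : (v.map fun i => if i = y then (0 : ℂ) else 1) = v.map fun _ => 1 :=
          List.map_congr_left fun i hi => if_neg fun h : i = y => hyv (h ▸ hi)
        rw [h1]
        simp
    have hT : convProd P Finset.univ (fun κ => pull (ψ κ) (mask f fun i => b i = κ))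
        (word f (List.finRange n)) = 0 := by
      have e := pull_convProd P (scale_mem_primitive (f := f) fun i => if i = y then (0 : ℂ) else 1)
        Finset.univ (fun κ => pull (ψ κ) (mask f fun i => b i = κ))
      change pull _ (scale f _) = convProd P Finset.univ (fun κ => pull _ (scale f _)) at e
      simp only [hs] at e
      rw [← e, pull_apply, scale_word _ hne, map_smul, smul_eq_mul]
      have h0 : ((List.finRange n).map fun i => if i = y then (0 : ℂ) else 1).prod = 0 :=
        List.prod_eq_zero (List.mem_map.2 ⟨y, List.mem_finRange y, if_pos rfl⟩)
      rw [h0, zero_mul]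
    rw [hT, eq_comm]
    refine mul_eq_zero_of_right _ (Finset.prod_eq_zero (Finset.mem_univ (b y)) ?_)
    have hyf : y ∈ (Finset.univ.filter fun i => b i = b y).sort (· ≤ ·) := by
      rw [Finset.mem_sort, Finset.mem_filter]
      exact ⟨Finset.mem_univ _, rfl⟩
    refine hw _ _ (List.ne_nil_of_mem hyf) ?_
    intro h
    exact hy (by rw [← h]; exact hyf)
  · push Not at hc
    choose y hy using hb
    -- One representative letter `y κ` of each fibre is scaled by `t κ`. It occurs exactly once in
    -- `w κ`, so the `κ`-th functional is multiplied by `t κ`, while the full word is multiplied by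
    -- `∏ t κ`.
    let c : (Fin (k + 1) → ℂ) → Fin n → ℂ := fun t i => if i = y (b i) then t (b i) else 1
    have hs : ∀ t κ, pull (pull (ψ κ) (mask f fun i => b i = κ)) (scale f (c t)) =
        pull (t κ • ψ κ) (mask f fun i => b i = κ) := by
      intro t κ
      refine ext_word fun v hv => ?_
      rw [pull_apply, scale_word _ hv, map_smul, smul_eq_mul, pull_apply, pull_apply]
      by_cases hvκ : ∀ i ∈ v, b i = κ
      · rw [mask_word_of_forall hvκ, LinearMap.smul_apply, smul_eq_mul]
        by_cases hvw : v = w κ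
        · have h1 : v.map (c t) = v.map fun i => if i = y κ then t κ else 1 :=
            List.map_congr_left fun i hi => by simp only [c, hvκ i hi]
          have h2 : y κ ∈ v := by
            rw [hvw]
            have := hc (y κ)
            rwa [hy κ] at this
          rw [h1, prod_ite_eq_of_nodup (hvw ▸ hwn κ) h2]
        · rw [hw κ v hv hvw, mul_zero, mul_zero]
      · push Not at hvκ
        rw [mask_word_of_exists hvκ, map_zero, map_zero, mul_zero]
    have hc : ∀ t, ((List.finRange n).map (c t)).prod = ∏ κ, t κ := by
      intro t
      rw [← Fin.prod_univ_def, ← Finset.prod_fiberwise Finset.univ b]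
      refine Finset.prod_congr rfl fun κ _ => ?_
      have : ∀ i ∈ Finset.univ.filter (fun i => b i = κ), c t i = if i = y κ then t κ else 1 := by
        intro i hi
        simp only [c, (Finset.mem_filter.1 hi).2]
      rw [Finset.prod_congr rfl this, Finset.prod_ite_eq', if_pos]
      exact Finset.mem_filter.2 ⟨Finset.mem_univ _, hy κ⟩
    have hm := hH k n b f (fun κ => ⟨y κ, hy κ⟩) (fun _ => Free f) ψ (fun _ i => gen f i)
      (fun i => gen_mem_face f i)
    refine Eq.trans ?_ hm
    rw [← mixedPartial_prod_mul (k + 1) (convProd P Finset.univ _ _)]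
    congr 1
    funext t
    rw [← convProd_mask_eq_iter P b fun κ => t κ • ψ κ, ← hc t]
    have e := pull_convProd P (scale_mem_primitive (f := f) (c t))
      Finset.univ (fun κ => pull (ψ κ) (mask f fun i => b i = κ))
    change pull _ (scale f _) = convProd P Finset.univ (fun κ => pull _ (scale f _)) at e
    simp only [hs] at e
    rw [← e, pull_apply, scale_word _ hne, map_smul, smul_eq_mul]

variable {S : Type} [Fintype S]

/-- The image of `j` is enumerated to obtain a surjective labelling; a label outside the image
yields the zero functional, the unit of convolution. -/
theorem convProd_mask (hn : n ≠ 0) (hH : P.HasHighestCoefficients w₀) (j : Fin n → S)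
    {ψ : S → (Free.{u} f).Functional} (hψ : ∀ s, IsSingle (ψ s)) :
    convProd P Finset.univ (fun s => pull (ψ s) (mask f fun i => j i = s))
        (word f (List.finRange n)) =
      w₀ n f (kerPartition j) *
        ∏ s ∈ Finset.univ.image j,
          ψ s (word f ((Finset.univ.filter fun i => j i = s).sort (· ≤ ·))) := by
  have hpos : 0 < (Finset.univ.image j).card := by
    rw [Finset.card_pos]
    exact ⟨_, Finset.mem_image_of_mem j (Finset.mem_univ ⟨0, Nat.pos_of_ne_zero hn⟩)⟩
  obtain ⟨k, hk⟩ : ∃ k, (Finset.univ.image j).card = k + 1 := ⟨_, (Nat.succ_pred_eq_of_pos hpos).symm⟩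
  let e : {s // s ∈ Finset.univ.image j} ≃ Fin (k + 1) := Finset.equivFinOfCardEq hk
  let j' : Fin n → {s // s ∈ Finset.univ.image j} :=
    fun i => ⟨j i, Finset.mem_image_of_mem j (Finset.mem_univ i)⟩
  have hb : Function.Surjective fun i => e (j' i) := by
    intro κ
    obtain ⟨i, -, hi⟩ := Finset.mem_image.1 (e.symm κ).2
    refine ⟨i, ?_⟩
    rw [← e.eq_symm_apply]
    exact Subtype.ext hi
  have hje : ∀ (i : Fin n) (s : {s // s ∈ Finset.univ.image j}), e (j' i) = e s ↔ j i = s :=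
    fun i s => by rw [e.apply_eq_iff_eq, Subtype.ext_iff]
  have h := convProd_mask_of_surjective P hH hb (ψ := fun κ => ψ (e.symm κ)) fun κ => hψ _
  have hker : (kerPartition fun i => e (j' i)) = kerPartition j := by
    unfold kerPartition
    congr 1
    ext x y
    simp only [Setoid.ker_def]
    exact hje x (j' y)
  rw [hker, ← Equiv.prod_comp e] at h
  simp only [Equiv.symm_apply_apply, hje] at h
  rw [Finset.prod_coe_sort (Finset.univ.image j)
    fun s => ψ s (word f ((Finset.univ.filter fun i => j i = s).sort (· ≤ ·)))] at h
  rw [← h]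
  congr 1
  rw [convProd, convProd, ← Equiv.prod_comp e]
  simp only [Equiv.symm_apply_apply, hje]
  rw [Finset.prod_coe_sort (Finset.univ.image j)
    fun s => toConv P (pull (ψ s) (mask f fun i => j i = s))]
  congr 1
  refine (Finset.prod_subset (Finset.subset_univ _) fun s _ hs => ?_).symm
  have : pull (ψ s) (mask f fun i => j i = s) = 0 := by
    refine ext_word fun v hv => ?_
    obtain ⟨i, hi⟩ := List.exists_mem_of_ne_nil v hv
    rw [pull_apply, mask_word_of_exists, map_zero, LinearMap.zero_apply]
    exact ⟨i, hi, fun h => hs (Finset.mem_image.2 ⟨i, Finset.mem_univ _, h⟩)⟩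
  rw [this]
  rfl

/-- Each letter is replaced by the sum of copies indexed by `S`, with the copy `s` visible only to
the `s`-th functional. Multilinear expansion assigns a label to every leg, which is what the masks
record. -/
theorem convProd_finRange_eq_sum (hn : n ≠ 0) (ψ : S → (Free.{u} f).Functional) :
    convProd P Finset.univ ψ (word f (List.finRange n)) =
      ∑ j : Fin n → S, convProd P Finset.univ (fun s => pull (ψ s) (mask f fun i => j i = s))
        (word f (List.finRange n)) := by
  let g : Fin n × S → F := fun x => f x.1
  let Ψ : S → (Free.{u} g).Functional := fun s =>
    pull (ψ s) (lift g fun x => if x.2 = s then gen f x.1 else 0)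
  have hy : ∀ i, ∑ s, gen g (i, s) ∈ primitive.{u} g (f i) :=
    fun i => sum_mem fun s _ => gen_mem_primitive g (i, s)
  have hy' : ∀ (j : Fin n → S) (i), gen g (i, j i) ∈ primitive.{u} g (f i) :=
    fun j i => gen_mem_primitive g (i, j i)
  have h1 : ∀ s, pull (Ψ s) (lift f fun i => ∑ s, gen g (i, s)) = ψ s := by
    intro s
    rw [pull_pull]
    refine Eq.trans (congrArg (pull (ψ s)) (hom_ext (h' := NonUnitalAlgHom.id ℂ _) fun i => ?_)) rfl
    rw [NonUnitalAlgHom.comp_apply, lift_gen, map_sum]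
    simp only [lift_gen, Finset.sum_ite_eq', Finset.mem_univ, if_true]
    rfl
  have h2 : ∀ (j : Fin n → S) s, pull (Ψ s) (lift f fun i => gen g (i, j i)) =
      pull (ψ s) (mask f fun i => j i = s) := by
    intro j s
    rw [pull_pull]
    refine congrArg (pull (ψ s)) (hom_ext fun i => ?_)
    rw [NonUnitalAlgHom.comp_apply, lift_gen, lift_gen, mask, lift_gen]
  have h3 := pull_convProd P hy Finset.univ Ψ
  simp only [h1] at h3
  rw [← h3, pull_apply, lift_word, ← List.ofFn_eq_map, nprod_ofFn_sum hn, map_sum]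
  refine Finset.sum_congr rfl fun j _ => ?_
  have h4 := pull_convProd P (hy' j) Finset.univ Ψ
  simp only [h2] at h4
  rw [← h4, pull_apply, lift_word, ← List.ofFn_eq_map]

/-- Expanding the product of sums on the right labels the blocks of `σ` by elements of `S`.
Injective labellings correspond to the maps `j` with kernel `σ`; the others contribute zero. -/
theorem sum_ker_eq (σ : LegPartition n) {ψ : S → (Free.{u} f).Functional}
    (hψ : ∀ s, IsSingle (ψ s)) :
    ∑ j ∈ Finset.univ.filter (fun j : Fin n → S => kerPartition j = σ),
        ∏ s ∈ Finset.univ.image j,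
          ψ s (word f ((Finset.univ.filter fun i => j i = s).sort (· ≤ ·))) =
      ∏ β ∈ σ.parts, ∑ s, ψ s (word f (β.sort (· ≤ ·))) := by
  rw [← Finset.prod_coe_sort, Finset.prod_univ_sum, Fintype.piFinset_univ]
  have hne : ∀ β : σ.parts, ∃ i, i ∈ (β : Finset (Fin n)) :=
    fun β => Finpartition.nonempty_of_mem_parts _ β.2
  choose r hr using hne
  have hpart : ∀ i, σ.part i ∈ σ.parts := fun i => (Finpartition.part_mem _).2 (Finset.mem_univ i)
  have hmem : ∀ i, i ∈ σ.part i := fun i => (Finpartition.mem_part_self _).2 (Finset.mem_univ i)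
  have hfib : ∀ j : Fin n → S, kerPartition j = σ → ∀ β ∈ σ.parts, ∀ i ∈ β,
      β = Finset.univ.filter fun i' => j i' = j i := by
    rintro j rfl β hβ i hi
    rw [kerPartition_parts, Finset.mem_image] at hβ
    obtain ⟨s, -, rfl⟩ := hβ
    rw [(Finset.mem_filter.1 hi).2]
  refine Finset.sum_of_injOn (fun j β => j (r β)) ?_ (fun _ _ => Finset.mem_coe.2 (Finset.mem_univ _)) ?_ ?_
  · intro j hj j' hj' h
    have hj := (Finset.mem_filter.1 (Finset.mem_coe.1 hj)).2
    have hj' := (Finset.mem_filter.1 (Finset.mem_coe.1 hj')).2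
    have key : ∀ j : Fin n → S, kerPartition j = σ → ∀ i, j i = j (r ⟨σ.part i, hpart i⟩) := by
      intro j hj i
      have h1 := hfib j hj _ (hpart i) _ (hmem i)
      have h2 := hr ⟨σ.part i, hpart i⟩
      exact (Finset.mem_filter.1 ((Finset.ext_iff.1 h1 _).1 h2)).2.symm
    funext i
    rw [key j hj i, key j' hj' i]
    exact congrFun h _
  · intro g _ hg
    have hinj : ¬ Function.Injective g := by
      intro hinj
      refine hg ⟨fun i => g ⟨σ.part i, hpart i⟩, ?_, ?_⟩
      · refine Finset.mem_coe.2 (Finset.mem_filter.2 ⟨Finset.mem_univ _, ?_⟩)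
        apply Finpartition.ext
        have e : ∀ i, (Finset.univ.filter fun i' => g ⟨σ.part i', hpart i'⟩ = g ⟨σ.part i, hpart i⟩) =
            σ.part i := by
          intro i
          ext i'
          rw [Finset.mem_filter, and_iff_right (Finset.mem_univ _), hinj.eq_iff, Subtype.mk.injEq,
            Finpartition.mem_part_iff_part_eq_part _ (Finset.mem_univ _) (Finset.mem_univ _)]
        rw [kerPartition_parts, Finset.image_image]
        ext β
        rw [Finset.mem_image]
        constructor
        · rintro ⟨i, -, rfl⟩
          rw [Function.comp_apply, e]
          exact hpart i
        · intro hβ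
          refine ⟨r ⟨β, hβ⟩, Finset.mem_univ _, ?_⟩
          rw [Function.comp_apply, e]
          exact Finpartition.part_eq_of_mem _ hβ (hr ⟨β, hβ⟩)
      · funext β
        change g _ = g β
        congr 1
        exact Subtype.ext (Finpartition.part_eq_of_mem _ β.2 (hr β))
    -- Two different blocks now carry the same functional, which is nonzero on at most one word, so
    -- one of the two factors vanishes.
    rw [Function.Injective] at hinj
    push Not at hinj
    obtain ⟨β, γ, h1, h2⟩ := hinj
    obtain ⟨w, -, hw⟩ := hψ (g β)
    have hnil : ∀ δ : σ.parts, (δ : Finset (Fin n)).sort (· ≤ ·) ≠ [] := fun δ =>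
      List.ne_nil_of_mem ((Finset.mem_sort _).2 (hr δ))
    by_cases hβ : (β : Finset (Fin n)).sort (· ≤ ·) = w
    · refine Finset.prod_eq_zero (Finset.mem_univ γ) ?_
      rw [← h1]
      refine hw _ (hnil γ) fun h => h2 (Subtype.ext ?_)
      rw [← Finset.sort_toFinset (β : Finset (Fin n)) (· ≤ ·), hβ, ← h, Finset.sort_toFinset]
    · exact Finset.prod_eq_zero (Finset.mem_univ β) (hw _ (hnil β) hβ)
  · intro j hj
    have hj := (Finset.mem_filter.1 hj).2
    have hm : ∀ s ∈ Finset.univ.image j, (Finset.univ.filter fun i => j i = s) ∈ σ.parts := by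
      intro s hs
      rw [← hj, kerPartition_parts]
      exact Finset.mem_image_of_mem _ hs
    refine Finset.prod_bij (fun s hs => ⟨_, hm s hs⟩) (fun _ _ => Finset.mem_univ _) ?_ ?_ ?_
    · intro s hs s' hs' h
      obtain ⟨i, -, rfl⟩ := Finset.mem_image.1 hs
      have h1 : i ∈ Finset.univ.filter fun i' => j i' = j i :=
        Finset.mem_filter.2 ⟨Finset.mem_univ _, rfl⟩
      rw [Subtype.mk.inj h] at h1
      exact (Finset.mem_filter.1 h1).2
    · intro β _
      refine ⟨j (r β), Finset.mem_image_of_mem _ (Finset.mem_univ _), Subtype.ext ?_⟩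
      exact (hfib j hj _ β.2 _ (hr β)).symm
    · intro s hs
      have h1 := hr ⟨_, hm s hs⟩
      have h2 := (Finset.mem_filter.1 h1).2
      dsimp only
      rw [h2]

/-- The values of a convolution of functionals supported on single words are given by the highest
coefficients. -/
theorem convProd_finRange (hn : n ≠ 0) (hH : P.HasHighestCoefficients w₀)
    {ψ : S → (Free.{u} f).Functional} (hψ : ∀ s, IsSingle (ψ s)) :
    convProd P Finset.univ ψ (word f (List.finRange n)) =
      ∑ σ : LegPartition n, w₀ n f σ * ∏ β ∈ σ.parts, ∑ s, ψ s (word f (β.sort (· ≤ ·))) := by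
  rw [convProd_finRange_eq_sum P hn,
    Finset.sum_congr rfl fun j _ => convProd_mask P hn hH j hψ,
    ← Finset.sum_fiberwise Finset.univ (fun j : Fin n → S => kerPartition j)]
  refine Finset.sum_congr rfl fun σ _ => ?_
  rw [← sum_ker_eq σ hψ, Finset.mul_sum]
  refine Finset.sum_congr rfl fun j hj => ?_
  rw [(Finset.mem_filter.1 hj).2]

end Core

/-! ### Cumulants -/

section Cumulants

variable {n : ℕ} {f : Fin n → F}

/-- The weights are one on one-block partitions. -/
def IsNormalized (w₀ : ∀ m : ℕ, (Fin m → F) → LegPartition m → ℂ) : Prop :=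
  ∀ m f π, Finset.univ ∈ π.parts → w₀ m f π = 1

theorem parts_eq_singleton_univ {m : ℕ} {π : LegPartition m} (h : Finset.univ ∈ π.parts) :
    π.parts = {Finset.univ} := by
  refine Finset.eq_singleton_iff_unique_mem.2 ⟨h, fun β hβ => ?_⟩
  obtain ⟨i, hi⟩ := Finpartition.nonempty_of_mem_parts _ hβ
  exact Finpartition.eq_of_mem_parts _ hβ h hi (Finset.mem_univ i)

theorem exists_univ_mem_parts {m : ℕ} (hm : m ≠ 0) :
    ∃ π : LegPartition m, Finset.univ ∈ π.parts :=
  ⟨Finpartition.indiscrete (by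
    rw [Finset.bot_eq_empty, ← Finset.nonempty_iff_ne_empty]
    exact ⟨⟨0, Nat.pos_of_ne_zero hm⟩, Finset.mem_univ _⟩), Finset.mem_singleton_self _⟩

theorem length_sort_map {m : ℕ} (v : Fin m → Fin n) (β : Finset (Fin m)) :
    ((β.sort (· ≤ ·)).map v).length = β.card := by
  rw [List.length_map, Finset.length_sort]

/-- The length of the list equals `m` only propositionally. This transport allows a function on
lists to be defined from one on tuples of varying length. -/
theorem apply_get_map_finRange {T R : Type*} (Z : ∀ m : ℕ, (Fin m → T) → R) {m : ℕ}
    (v : Fin m → T) : Z _ ((List.finRange m).map v).get = Z m v := by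
  have key : ∀ (m' : ℕ) (h : m = m') (v' : Fin m' → T), (∀ i, v' i = v (Fin.cast h.symm i)) →
      Z m' v' = Z m v := by
    rintro m' rfl v' hv'
    obtain rfl : v' = v := funext hv'
    rfl
  have hlen : m = ((List.finRange m).map v).length := by
    rw [List.length_map, List.length_finRange]
  refine key _ hlen _ fun i => ?_
  rw [List.get_eq_getElem, List.getElem_map, List.getElem_finRange]
  rfl

/-- The formula is triangular in the length of words: the one-block partition contributes the
cumulant of the whole word with coefficient 1, all other partitions only cumulants of shorter words.
-/
theorem exists_cumulants {w₀ : ∀ m : ℕ, (Fin m → F) → LegPartition m → ℂ} (hw : IsNormalized w₀)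
    (φ : (Free.{u} f).Functional) (L : ℕ) :
    ∃ K : List (Fin n) → ℂ, ∀ (m : ℕ) (v : Fin m → Fin n), m ≠ 0 → m ≤ L →
      φ (word f ((List.finRange m).map v)) =
        ∑ σ : LegPartition m, w₀ m (f ∘ v) σ * ∏ β ∈ σ.parts, K ((β.sort (· ≤ ·)).map v) := by
  induction L with
  | zero => exact ⟨fun _ => 0, fun m v h0 h1 => absurd (Nat.le_zero.1 h1) h0⟩
  | succ L ih =>
    obtain ⟨K, hK⟩ := ih
    obtain ⟨Z, hZ⟩ : ∃ Z : ∀ m : ℕ, (Fin m → Fin n) → ℂ, ∀ m v, Z m v =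
        ∑ σ ∈ Finset.univ.filter (fun σ : LegPartition m => Finset.univ ∉ σ.parts),
          w₀ m (f ∘ v) σ * ∏ β ∈ σ.parts, K ((β.sort (· ≤ ·)).map v) := ⟨_, fun _ _ => rfl⟩
    obtain ⟨g, hg⟩ : ∃ g : List (Fin n) → ℂ, ∀ (m : ℕ) (v : Fin m → Fin n),
        g ((List.finRange m).map v) = φ (word f ((List.finRange m).map v)) - Z m v :=
      ⟨fun u => φ (word f u) - Z u.length u.get, fun m v => by
        beta_reduce
        rw [apply_get_map_finRange Z v]⟩
    -- Only the values at length `L + 1` are redefined, so the formula for shorter words persists;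
    -- `g` is the moment minus the contribution of partitions with smaller blocks.
    refine ⟨fun u => if u.length = L + 1 then g u else K u, fun m v h0 h1 => ?_⟩
    have hlow : ∀ σ : LegPartition m, (∀ β ∈ σ.parts, β.card ≤ L) →
        ∏ β ∈ σ.parts, (if ((β.sort (· ≤ ·)).map v).length = L + 1 then g ((β.sort (· ≤ ·)).map v)
          else K ((β.sort (· ≤ ·)).map v)) = ∏ β ∈ σ.parts, K ((β.sort (· ≤ ·)).map v) := by
      intro σ hσ
      refine Finset.prod_congr rfl fun β hβ => if_neg ?_
      rw [length_sort_map]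
      have := hσ β hβ
      omega
    rcases Nat.lt_or_ge L m with hm | hm
    · obtain rfl : m = L + 1 := by omega
      obtain ⟨π, hπ⟩ := exists_univ_mem_parts h0
      have hone : Finset.univ.filter (fun σ : LegPartition (L + 1) => Finset.univ ∈ σ.parts) = {π} := by
        refine Finset.eq_singleton_iff_unique_mem.2 ⟨Finset.mem_filter.2 ⟨Finset.mem_univ _, hπ⟩, ?_⟩
        intro σ hσ
        apply Finpartition.ext
        rw [parts_eq_singleton_univ (Finset.mem_filter.1 hσ).2, parts_eq_singleton_univ hπ]
      rw [← Finset.sum_filter_add_sum_filter_not Finset.univ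
        (fun σ : LegPartition (L + 1) => Finset.univ ∈ σ.parts), hone, Finset.sum_singleton,
        hw _ _ _ hπ, parts_eq_singleton_univ hπ, Finset.prod_singleton, one_mul]
      beta_reduce
      rw [length_sort_map, Finset.card_univ, Fintype.card_fin, if_pos rfl, Fin.sort_univ, hg, hZ]
      rw [eq_comm, sub_add_eq_add_sub, sub_eq_iff_eq_add]
      congr 1
      refine Finset.sum_congr rfl fun σ hσ => ?_
      rw [hlow σ fun β hβ => ?_]
      have h2 : β ≠ Finset.univ := fun h => (Finset.mem_filter.1 hσ).2 (h ▸ hβ)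
      have h3 := (Finset.card_lt_iff_ne_univ β).2 h2
      rw [Fintype.card_fin] at h3
      omega
    · rw [hK m v h0 hm]
      refine Finset.sum_congr rfl fun σ _ => ?_
      rw [hlow σ fun β _ => (Finset.card_le_univ β).trans (by rwa [Fintype.card_fin])]

/-- Cumulants of words with a forbidden letter can be set to zero: the block of such a letter then
annihilates every term, matching the vanishing moment, while words of allowed letters have only
allowed subwords. -/
theorem exists_cumulants_of_mask {w₀ : ∀ m : ℕ, (Fin m → F) → LegPartition m → ℂ}
    (hw : IsNormalized w₀) {φ : (Free.{u} f).Functional} {c : Fin n → Prop}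
    (hφ : ∀ v : List (Fin n), (∃ i ∈ v, ¬ c i) → φ (word f v) = 0) (L : ℕ) :
    ∃ K : List (Fin n) → ℂ, (∀ v, (∃ i ∈ v, ¬ c i) → K v = 0) ∧
      ∀ (m : ℕ) (v : Fin m → Fin n), m ≠ 0 → m ≤ L →
        φ (word f ((List.finRange m).map v)) =
          ∑ σ : LegPartition m, w₀ m (f ∘ v) σ * ∏ β ∈ σ.parts, K ((β.sort (· ≤ ·)).map v) := by
  obtain ⟨K, hK⟩ := exists_cumulants hw φ L
  refine ⟨fun v => if ∃ i ∈ v, ¬ c i then 0 else K v, fun v hv => if_pos hv, fun m v h0 h1 => ?_⟩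
  by_cases hv : ∃ i, ¬ c (v i)
  · obtain ⟨i, hi⟩ := hv
    rw [hφ _ ⟨v i, List.mem_map_of_mem (List.mem_finRange i), hi⟩, eq_comm]
    refine Finset.sum_eq_zero fun σ _ => mul_eq_zero_of_right _ ?_
    refine Finset.prod_eq_zero ((Finpartition.part_mem σ).2 (Finset.mem_univ i)) (if_pos ?_)
    refine ⟨v i, List.mem_map_of_mem ((Finset.mem_sort _).2 ?_), hi⟩
    exact (Finpartition.mem_part_self σ).2 (Finset.mem_univ i)
  · push Not at hv
    rw [hK m v h0 h1]
    refine Finset.sum_congr rfl fun σ _ => ?_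
    congr 1
    refine Finset.prod_congr rfl fun β _ => (if_neg ?_).symm
    rintro ⟨i, hi, hc⟩
    obtain ⟨i', -, rfl⟩ := List.mem_map.1 hi
    exact hc (hv i')

variable (P : UniversalProduct.{u} F) [hP : Fact P.IsSymmetric]
variable {w₀ : ∀ m : ℕ, (Fin m → F) → LegPartition m → ℂ}

theorem IsSingle.pull_lift {ψ : (Free.{u} f).Functional} (hψ : IsSingle ψ) {m : ℕ}
    {v : Fin m → Fin n} (hv : Function.Injective v) :
    IsSingle (pull ψ (lift (f ∘ v) fun i => gen f (v i))) := by
  obtain ⟨w, hwn, hw⟩ := hψ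
  by_cases h : ∃ w', List.map v w' = w
  · obtain ⟨w', rfl⟩ := h
    refine ⟨w', List.Nodup.of_map v hwn, fun u hu hne => ?_⟩
    rw [pull_apply, lift_gen_word]
    exact hw _ (by simpa using hu) fun h => hne (List.map_injective_iff.2 hv h)
  -- No word in the new letters maps to the supporting word, so the pullback vanishes on all
  -- nonempty words and the empty word serves as witness.
  · refine ⟨[], List.nodup_nil, fun u hu _ => ?_⟩
    rw [pull_apply, lift_gen_word]
    exact hw _ (by simpa using hu) fun h' => h ⟨u, h'⟩

theorem convProd_word_map (hH : P.HasHighestCoefficients w₀) {S : Type} [Fintype S]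
    {ψ : S → (Free.{u} f).Functional} (hψ : ∀ s, IsSingle (ψ s)) {m : ℕ} (hm : m ≠ 0)
    {v : Fin m → Fin n} (hv : Function.Injective v) :
    convProd P Finset.univ ψ (word f ((List.finRange m).map v)) =
      ∑ σ : LegPartition m, w₀ m (f ∘ v) σ *
        ∏ β ∈ σ.parts, ∑ s, ψ s (word f ((β.sort (· ≤ ·)).map v)) := by
  have hy : ∀ i, gen f (v i) ∈ primitive.{u} f ((f ∘ v) i) := fun i => gen_mem_primitive f (v i)
  rw [← lift_gen_word (f := f ∘ v) v, ← pull_apply, pull_convProd P hy,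
    convProd_finRange P hm hH fun s => (hψ s).pull_lift hv]
  simp only [pull_apply, lift_gen_word]

/-- On words without repetition, `φ κ` agrees with the convolution of single-word functionals
weighted by its cumulants. Convolving over `κ` merges all of these into one family, whose values are
known; the cumulants of the convolution are therefore the sums over `κ` of the individual ones. -/
theorem exists_moment_cumulant (hw : IsNormalized w₀) (hH : P.HasHighestCoefficients w₀) {k : ℕ}
    {b : Fin n → Fin (k + 1)} {φ : Fin (k + 1) → (Free.{u} f).Functional}
    (hφ : ∀ κ, ∀ v : List (Fin n), (∃ i ∈ v, b i ≠ κ) → φ κ (word f v) = 0) :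
    ∃ C : List (Fin n) → ℂ, (∀ v, C v ≠ 0 → ∃ κ, ∀ i ∈ v, b i = κ) ∧
      ∀ (m : ℕ) (v : Fin m → Fin n), m ≠ 0 → Function.Injective v →
        convProd P Finset.univ φ (word f ((List.finRange m).map v)) =
          ∑ σ : LegPartition m, w₀ m (f ∘ v) σ * ∏ β ∈ σ.parts, C ((β.sort (· ≤ ·)).map v) := by
  choose K hK0 hK using fun κ => exists_cumulants_of_mask hw (hφ κ) n
  -- Words without repetition are finitely many and have length at most `n`, so the convolution is
  -- finite and cumulants up to length `n` suffice.
  let ψ : Fin (k + 1) × {w : List (Fin n) // w.Nodup} → (Free.{u} f).Functional :=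
    fun s => ofWords f fun v => if v = s.2.1 then K s.1 v else 0
  have hψ : ∀ s, IsSingle (ψ s) := fun s =>
    ⟨s.2.1, s.2.2, fun v hv hne => by rw [ofWords_word _ hv, if_neg hne]⟩
  have hsum : ∀ κ (u : List (Fin n)), u.Nodup → u ≠ [] →
      ∑ w : {w : List (Fin n) // w.Nodup}, ψ (κ, w) (word f u) = K κ u := by
    intro κ u hu hne
    rw [Finset.sum_eq_single ⟨u, hu⟩, ofWords_word _ hne, if_pos rfl]
    · intro w _ hwu
      rw [ofWords_word _ hne, if_neg]
      exact fun h => hwu (Subtype.ext h.symm)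
    · exact fun h => absurd (Finset.mem_univ _) h
  have hblock : ∀ {m : ℕ} {v : Fin m → Fin n}, Function.Injective v → ∀ (σ : LegPartition m),
      ∀ β ∈ σ.parts, ((β.sort (· ≤ ·)).map v).Nodup ∧ (β.sort (· ≤ ·)).map v ≠ [] := by
    intro m v hv σ β hβ
    refine ⟨(Finset.sort_nodup _ _).map hv, ?_⟩
    obtain ⟨i, hi⟩ := Finpartition.nonempty_of_mem_parts _ hβ
    exact List.ne_nil_of_mem (List.mem_map_of_mem ((Finset.mem_sort _).2 hi))
  have hagree : ∀ κ, AgreeOnNodup (φ κ) (convProd P Finset.univ fun w => ψ (κ, w)) := by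
    intro κ w hw0 hwn
    have hlen : w.length ≠ 0 := by simpa using hw0
    have hv : Function.Injective w.get := List.nodup_iff_injective_get.1 hwn
    have hle : w.length ≤ n := by
      have := Fintype.card_le_of_injective _ hv
      rwa [Fintype.card_fin, Fintype.card_fin] at this
    have e : w = (List.finRange w.length).map w.get := by
      rw [← List.ofFn_eq_map, List.ofFn_get]
    rw [e, hK κ _ _ hlen hle, convProd_word_map P hH (fun s => hψ (κ, s)) hlen hv]
    refine Finset.sum_congr rfl fun σ _ => ?_
    congr 1
    refine Finset.prod_congr rfl fun β hβ => ?_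
    rw [hsum κ _ (hblock hv σ β hβ).1 (hblock hv σ β hβ).2]
  refine ⟨fun u => ∑ κ, K κ u, fun v hv => ?_, fun m v hm hv => ?_⟩
  · obtain ⟨κ, -, hκ⟩ := Finset.exists_ne_zero_of_sum_ne_zero hv
    refine ⟨κ, fun i hi => ?_⟩
    by_contra h
    exact hκ (hK0 κ v ⟨i, hi, h⟩)
  · have hnd : ((List.finRange m).map v).Nodup := (List.nodup_finRange m).map hv
    have hne : (List.finRange m).map v ≠ [] := by simpa using hm
    rw [AgreeOnNodup.convProd P (fun κ _ => hagree κ) _ hne hnd]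
    have e : (convProd P Finset.univ fun κ => convProd P Finset.univ fun w => ψ (κ, w)) =
        convProd P Finset.univ ψ := by
      simp only [convProd, Equiv.apply_symm_apply]
      rw [Fintype.prod_prod_type]
    rw [e, convProd_word_map P hH hψ hm hv]
    refine Finset.sum_congr rfl fun σ _ => ?_
    congr 1
    refine Finset.prod_congr rfl fun β hβ => ?_
    rw [Fintype.sum_prod_type]
    exact Finset.sum_congr rfl fun κ _ => hsum κ _ (hblock hv σ β hβ).1 (hblock hv σ β hβ).2

end Cumulants

/-! ### Partition sets given by conditions on pairs of blocks -/

section Pairwise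

/-- Membership in the partition set is a condition on pairs of distinct blocks which passes to
subsets of the blocks and is compatible with order embeddings of the legs. -/
def IsPairwise (Pi : PartitionSet F) : Prop :=
  ∃ Q : ∀ n : ℕ, (Fin n → F) → Finset (Fin n) → Finset (Fin n) → Prop,
    (∀ n f π, π ∈ Pi n f ↔ ∀ β ∈ π.parts, ∀ γ ∈ π.parts, β ≠ γ → Q n f β γ) ∧
    (∀ n f β β' γ γ', β' ⊆ β → γ' ⊆ γ → Q n f β γ → Q n f β' γ') ∧
    ∀ m n (v : Fin m ↪o Fin n) f β γ,
      Q m (f ∘ v) β γ ↔ Q n f (β.map v.toEmbedding) (γ.map v.toEmbedding)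

variable {n : ℕ} {f : Fin n → F} {Pi : PartitionSet F}

theorem IsPairwise.mem_of_univ_mem (h : IsPairwise Pi) {π : LegPartition n}
    (hπ : Finset.univ ∈ π.parts) : π ∈ Pi n f := by
  obtain ⟨Q, hQ, -, -⟩ := h
  rw [hQ, parts_eq_singleton_univ hπ]
  intro β hβ γ hγ hne
  rw [Finset.mem_singleton] at hβ hγ
  exact absurd (hβ.trans hγ.symm) hne

/-- Two distinct blocks of a common refinement lie in distinct blocks of at least one of the two
partitions, and the pair condition passes to subsets. The empty meet is `⊤`, which has no two
distinct blocks. -/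
theorem IsPairwise.meet_mem (h : IsPairwise Pi) {R : Finset (LegPartition n)}
    (hR : ∀ σ ∈ R, σ ∈ Pi n f) : meet R ∈ Pi n f := by
  obtain ⟨Q, hQ, hmono, -⟩ := h
  refine Finset.inf_induction (p := fun σ => σ ∈ Pi n f) ?_ ?_ hR
  · rw [hQ]
    intro β hβ γ hγ hne
    exact absurd (Finpartition.parts_top_subsingleton _ hβ hγ) hne
  · intro σ hσ τ hτ
    rw [hQ] at hσ hτ ⊢
    intro β hβ γ hγ hne
    rw [Finpartition.parts_inf, Finset.mem_erase, Finset.mem_image] at hβ hγ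
    obtain ⟨-, ⟨p, q⟩, hpq, rfl⟩ := hβ
    obtain ⟨-, ⟨p', q'⟩, hpq', rfl⟩ := hγ
    obtain ⟨hp, hq⟩ := Finset.mem_product.1 hpq
    obtain ⟨hp', hq'⟩ := Finset.mem_product.1 hpq'
    by_cases hpp : p = p'
    · by_cases hqq : q = q'
      · exact absurd (by rw [hpp, hqq]) hne
      · exact hmono _ _ _ _ _ _ Finset.inter_subset_right Finset.inter_subset_right
          (hτ q hq q' hq' hqq)
    · exact hmono _ _ _ _ _ _ Finset.inter_subset_left Finset.inter_subset_left
        (hσ p hp p' hp' hpp)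

/-- The increasing enumeration of a set of legs. -/
def blockEmb (β : Finset (Fin n)) : Fin β.card ↪o Fin n := β.orderEmbOfFin rfl

theorem blockEmb_mem (β : Finset (Fin n)) (i : Fin β.card) : blockEmb β i ∈ β :=
  β.orderEmbOfFin_mem rfl i

theorem exists_blockEmb_eq {β : Finset (Fin n)} {x : Fin n} (hx : x ∈ β) :
    ∃ i, blockEmb β i = x := by
  have : x ∈ Set.range (β.orderEmbOfFin rfl) := by
    rw [Finset.range_orderEmbOfFin]; exact hx
  exact this

theorem map_blockEmb_subset {β : Finset (Fin n)} (δ : Finset (Fin β.card)) :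
    δ.map (blockEmb β).toEmbedding ⊆ β := by
  intro x hx
  obtain ⟨i, -, rfl⟩ := Finset.mem_map.1 hx
  exact blockEmb_mem β i

theorem exists_map_blockEmb_eq {β γ : Finset (Fin n)} (h : γ ⊆ β) :
    ∃ δ : Finset (Fin β.card), δ.map (blockEmb β).toEmbedding = γ := by
  refine ⟨Finset.univ.filter fun i => blockEmb β i ∈ γ, ?_⟩
  ext x
  rw [Finset.mem_map]
  constructor
  · rintro ⟨i, hi, rfl⟩
    exact (Finset.mem_filter.1 hi).2
  · intro hx
    obtain ⟨i, rfl⟩ := exists_blockEmb_eq (h hx)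
    exact ⟨i, Finset.mem_filter.2 ⟨Finset.mem_univ _, hx⟩, rfl⟩

/-- The restriction of a partition to a set of legs. -/
def restrictBlock (σ : LegPartition n) (β : Finset (Fin n)) : LegPartition β.card :=
  kerPartition fun i => σ.part (blockEmb β i)

theorem subset_of_le {σ ρ : LegPartition n} (h : σ ≤ ρ) {β γ : Finset (Fin n)}
    (hβ : β ∈ ρ.parts) (hγ : γ ∈ σ.parts) {x : Fin n} (hxβ : x ∈ β) (hxγ : x ∈ γ) : γ ⊆ β := by
  obtain ⟨c, hc, hle⟩ := h hγ
  rwa [Finpartition.eq_of_mem_parts _ hβ hc hxβ (hle hxγ)]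

theorem mem_kerPartition_parts {S : Type*} {j : Fin n → S} {β : Finset (Fin n)} :
    β ∈ (kerPartition j).parts ↔ ∃ i, ∀ i', i' ∈ β ↔ j i' = j i := by
  rw [kerPartition_parts, Finset.image_image, Finset.mem_image]
  constructor
  · rintro ⟨i, -, rfl⟩
    exact ⟨i, fun i' => by simp⟩
  · rintro ⟨i, hi⟩
    refine ⟨i, Finset.mem_univ _, ?_⟩
    ext i'
    simp [hi]

/-- Since `σ` refines `ρ`, none of its blocks is cut by `β`, so restriction merely selects the
blocks contained in `β`. -/
theorem mem_restrictBlock_parts {σ ρ : LegPartition n} (h : σ ≤ ρ) {β : Finset (Fin n)}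
    (hβ : β ∈ ρ.parts) (δ : Finset (Fin β.card)) :
    δ ∈ (restrictBlock σ β).parts ↔ δ.map (blockEmb β).toEmbedding ∈ σ.parts := by
  have hpart : ∀ x, σ.part x ∈ σ.parts := fun x => (Finpartition.part_mem _).2 (Finset.mem_univ x)
  have hmem : ∀ x, x ∈ σ.part x := fun x => (Finpartition.mem_part_self _).2 (Finset.mem_univ x)
  rw [restrictBlock, mem_kerPartition_parts]
  have key : ∀ i, (∀ i', i' ∈ δ ↔ σ.part (blockEmb β i') = σ.part (blockEmb β i)) →
      δ.map (blockEmb β).toEmbedding = σ.part (blockEmb β i) := by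
    intro i hi
    ext x
    rw [Finset.mem_map]
    constructor
    · rintro ⟨i', hi', rfl⟩
      rw [← (hi i').1 hi']
      exact hmem _
    · intro hx
      obtain ⟨i', rfl⟩ := exists_blockEmb_eq
        (subset_of_le h hβ (hpart _) (blockEmb_mem β i) (hmem _) hx)
      exact ⟨i', (hi i').2 (Finpartition.part_eq_of_mem _ (hpart _) hx), rfl⟩
  constructor
  · rintro ⟨i, hi⟩
    rw [key i hi]
    exact hpart _
  · intro hδ
    obtain ⟨x, hx⟩ := Finpartition.nonempty_of_mem_parts _ hδ
    obtain ⟨i, hi, rfl⟩ := Finset.mem_map.1 hx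
    refine ⟨i, fun i' => ?_⟩
    have e : σ.part (blockEmb β i) = δ.map (blockEmb β).toEmbedding :=
      Finpartition.part_eq_of_mem _ hδ hx
    rw [e]
    constructor
    · exact fun hi' => Finpartition.part_eq_of_mem _ hδ (Finset.mem_map_of_mem _ hi')
    · intro hi'
      have := hmem (blockEmb β i')
      rw [hi'] at this
      exact (Finset.mem_map' _).1 this

theorem blocks_eq_of_map_eq {ρ : LegPartition n} {β β' : Finset (Fin n)} (hβ : β ∈ ρ.parts)
    (hβ' : β' ∈ ρ.parts) {δ : Finset (Fin β.card)} {δ' : Finset (Fin β'.card)}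
    (hδ : δ.Nonempty) (h : δ.map (blockEmb β).toEmbedding = δ'.map (blockEmb β').toEmbedding) :
    β = β' := by
  obtain ⟨i, hi⟩ := hδ
  refine Finpartition.eq_of_mem_parts _ hβ hβ' (blockEmb_mem β i) ?_
  refine map_blockEmb_subset δ' ?_
  rw [← h]
  exact Finset.mem_map_of_mem _ hi

/-- Partitions of the blocks of `ρ` combine to a refinement of `ρ`. -/
theorem exists_glue (ρ : LegPartition n) (p : ∀ β ∈ ρ.parts, LegPartition β.card) :
    ∃ σ : LegPartition n, σ ≤ ρ ∧ ∀ γ, γ ∈ σ.parts ↔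
      ∃ (β : Finset (Fin n)) (hβ : β ∈ ρ.parts), ∃ δ ∈ (p β hβ).parts,
        δ.map (blockEmb β).toEmbedding = γ := by
  let parts : Finset (Finset (Fin n)) := Finset.univ.filter fun γ =>
    ∃ (β : Finset (Fin n)) (hβ : β ∈ ρ.parts), ∃ δ ∈ (p β hβ).parts,
        δ.map (blockEmb β).toEmbedding = γ
  have hparts : ∀ γ, γ ∈ parts ↔ ∃ (β : Finset (Fin n)) (hβ : β ∈ ρ.parts), ∃ δ ∈ (p β hβ).parts,
        δ.map (blockEmb β).toEmbedding = γ := fun γ => by simp [parts]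
  let σ : LegPartition n := Finpartition.ofExistsUnique parts (fun _ _ => Finset.subset_univ _) (by
      intro x hx
      obtain ⟨β, hβ, hxβ⟩ := ρ.exists_mem hx
      obtain ⟨i, rfl⟩ := exists_blockEmb_eq hxβ
      obtain ⟨δ, hδ, hi⟩ := (p β hβ).exists_mem (Finset.mem_univ i)
      refine ⟨_, ⟨(hparts _).2 ⟨β, hβ, δ, hδ, rfl⟩, Finset.mem_map_of_mem _ hi⟩, ?_⟩
      rintro γ ⟨hγ, hiγ⟩
      obtain ⟨β', hβ', δ', hδ', rfl⟩ := (hparts _).1 hγ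
      obtain rfl := Finpartition.eq_of_mem_parts _ hβ' hβ (map_blockEmb_subset δ' hiγ) hxβ
      obtain ⟨i', hi', hii⟩ := Finset.mem_map.1 hiγ
      obtain rfl := (blockEmb β').injective hii
      rw [Finpartition.eq_of_mem_parts _ hδ' hδ hi' hi]) (by
      rw [hparts]
      rintro ⟨β, hβ, δ, hδ, h⟩
      rw [Finset.map_eq_empty] at h
      exact Finpartition.ne_empty _ hδ h)
  refine ⟨σ, ?_, hparts⟩
  intro γ hγ
  obtain ⟨β, hβ, δ, hδ, rfl⟩ := (hparts γ).1 hγ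
  exact ⟨β, hβ, map_blockEmb_subset δ⟩

/-- Restriction and gluing identify the refinements of `ρ` inside `Π` with families of members of
`Π` on the blocks of `ρ`. Products over blocks are then products of products. -/
theorem IsPairwise.prod_sum_blocks (h : IsPairwise Pi) {ρ : LegPartition n} (hρ : ρ ∈ Pi n f)
    (g : Finset (Fin n) → ℂ) :
    ∏ β ∈ ρ.parts, ∑ τ ∈ Finset.univ.filter (fun τ => τ ∈ Pi β.card (f ∘ blockEmb β)),
        ∏ δ ∈ τ.parts, g (δ.map (blockEmb β).toEmbedding) =
      ∑ σ ∈ Finset.univ.filter (fun σ => σ ∈ Pi n f ∧ σ ≤ ρ), ∏ γ ∈ σ.parts, g γ := by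
  obtain ⟨Q, hQ, hmono, hmap⟩ := h
  rw [hQ] at hρ
  rw [Finset.prod_sum, eq_comm]
  refine Finset.sum_bij (fun σ _ β _ => restrictBlock σ β) ?_ ?_ ?_ ?_
  · intro σ hσ
    obtain ⟨hσ, hle⟩ := (Finset.mem_filter.1 hσ).2
    rw [hQ] at hσ
    refine Finset.mem_pi.2 fun β hβ => Finset.mem_filter.2 ⟨Finset.mem_univ _, ?_⟩
    rw [hQ]
    intro δ hδ δ' hδ' hne
    rw [hmap]
    exact hσ _ ((mem_restrictBlock_parts hle hβ δ).1 hδ) _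
      ((mem_restrictBlock_parts hle hβ δ').1 hδ') fun h => hne (Finset.map_injective _ h)
  · have key : ∀ σ τ : LegPartition n, σ ≤ ρ → τ ≤ ρ →
        (∀ β ∈ ρ.parts, restrictBlock σ β = restrictBlock τ β) → σ.parts ⊆ τ.parts := by
      intro σ τ hσ hτ h γ hγ
      obtain ⟨β, hβ, hle⟩ := hσ hγ
      obtain ⟨δ, rfl⟩ := exists_map_blockEmb_eq hle
      rw [← mem_restrictBlock_parts hτ hβ, ← h β hβ, mem_restrictBlock_parts hσ hβ]
      exact hγ
    intro σ hσ τ hτ heq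
    have hσ := (Finset.mem_filter.1 hσ).2.2
    have hτ := (Finset.mem_filter.1 hτ).2.2
    have heq' : ∀ β ∈ ρ.parts, restrictBlock σ β = restrictBlock τ β := fun β hβ =>
      congrFun (congrFun heq β) hβ
    exact Finpartition.ext (Finset.Subset.antisymm (key σ τ hσ hτ heq')
      (key τ σ hτ hσ fun β hβ => (heq' β hβ).symm))
  · intro p hp
    obtain ⟨σ, hle, hσ⟩ := exists_glue ρ p
    refine ⟨σ, Finset.mem_filter.2 ⟨Finset.mem_univ _, ?_, hle⟩, ?_⟩
    · rw [hQ]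
      intro γ hγ γ' hγ' hne
      obtain ⟨β, hβ, δ, hδ, rfl⟩ := (hσ γ).1 hγ
      obtain ⟨β', hβ', δ', hδ', rfl⟩ := (hσ γ').1 hγ'
      by_cases hββ : β = β'
      · subst hββ
        rw [← hmap]
        have := (Finset.mem_filter.1 (Finset.mem_pi.1 hp β hβ)).2
        rw [hQ] at this
        exact this δ hδ δ' hδ' fun h => hne (by rw [h])
      -- Blocks inside different blocks of `ρ` satisfy the pair condition automatically, because `ρ`
      -- itself belongs to `Π`.
      · exact hmono _ _ _ _ _ _ (map_blockEmb_subset δ) (map_blockEmb_subset δ')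
          (hρ β hβ β' hβ' hββ)
    · funext β hβ
      apply Finpartition.ext
      ext δ
      rw [mem_restrictBlock_parts hle hβ, hσ]
      constructor
      · rintro ⟨β', hβ', δ', hδ', heq⟩
        obtain rfl := blocks_eq_of_map_eq hβ' hβ (Finpartition.nonempty_of_mem_parts _ hδ') heq
        rwa [← Finset.map_injective _ heq]
      · exact fun hδ => ⟨β, hβ, δ, hδ, rfl⟩
  · intro σ hσ
    have hle := (Finset.mem_filter.1 hσ).2.2
    rw [← Finset.prod_sigma (s := ρ.parts.attach)
      (t := fun x => (restrictBlock σ x.1).parts)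
      (f := fun x => g (x.2.map (blockEmb x.1.1).toEmbedding)), eq_comm]
    refine Finset.prod_bij (fun x _ => x.2.map (blockEmb x.1.1).toEmbedding) ?_ ?_ ?_ ?_
    · intro x hx
      exact (mem_restrictBlock_parts hle x.1.2 x.2).1 (Finset.mem_sigma.1 hx).2
    · rintro ⟨⟨β, hβ⟩, δ⟩ hx ⟨⟨β', hβ'⟩, δ'⟩ hx' heq
      have hδ := (Finset.mem_sigma.1 hx).2
      obtain rfl := blocks_eq_of_map_eq hβ hβ' (Finpartition.nonempty_of_mem_parts _ hδ) heq
      obtain rfl : δ = δ' := Finset.map_injective _ heq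
      rfl
    · intro γ hγ
      obtain ⟨β, hβ, hβγ⟩ := hle hγ
      obtain ⟨δ, rfl⟩ := exists_map_blockEmb_eq hβγ
      exact ⟨⟨⟨β, hβ⟩, δ⟩, Finset.mem_sigma.2 ⟨Finset.mem_attach _ _,
        (mem_restrictBlock_parts hle hβ δ).2 hγ⟩, rfl⟩
    · exact fun _ _ => rfl

/-- By finiteness every admissible refinement lies below a maximal one, so the index set on the left
is a union of down-sets; lying below all members of `R` is lying below `meet R`. -/
theorem sum_refinements_eq (Pi : PartitionSet F) (f : Fin n → F) (π : LegPartition n)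
    (G : LegPartition n → ℂ) :
    ∑ σ ∈ Finset.univ.filter (fun σ => σ ∈ Pi n f ∧ σ ≤ π), G σ =
      ∑ R ∈ (coarsestRefinements Pi f π).powerset.filter Finset.Nonempty,
        (-1 : ℂ) ^ (R.card - 1) *
          ∑ σ ∈ Finset.univ.filter (fun σ => σ ∈ Pi n f ∧ σ ≤ meet R), G σ := by
  let D : LegPartition n → Finset (LegPartition n) := fun ρ =>
    Finset.univ.filter fun σ => σ ∈ Pi n f ∧ σ ≤ ρ
  have hD : Finset.univ.filter (fun σ => σ ∈ Pi n f ∧ σ ≤ π) =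
      (coarsestRefinements Pi f π).biUnion D := by
    ext σ
    simp only [Finset.mem_filter, Finset.mem_univ, true_and, Finset.mem_biUnion, D,
      coarsestRefinements]
    constructor
    · intro hσ
      obtain ⟨ρ, hle, hρ⟩ := (Set.toFinite {τ | τ ∈ Pi n f ∧ τ ≤ π}).exists_le_maximal hσ
      exact ⟨ρ, hρ, hσ.1, hle⟩
    · rintro ⟨ρ, hρ, hσ, hle⟩
      exact ⟨hσ, hle.trans hρ.prop.2⟩
  rw [hD, Finset.inclusion_exclusion_sum_biUnion]
  rw [← Finset.sum_coe_sort ((coarsestRefinements Pi f π).powerset.filter Finset.Nonempty)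
    fun R => (-1 : ℂ) ^ (R.card - 1) *
          ∑ σ ∈ Finset.univ.filter (fun σ => σ ∈ Pi n f ∧ σ ≤ meet R), G σ]
  refine Finset.sum_congr rfl fun R _ => ?_
  have hR : R.1.Nonempty := (Finset.mem_filter.1 R.2).2
  -- The general inclusion-exclusion sign has exponent `R.card + 1`, of the same parity as `R.card -
  -- 1`; nonemptiness makes the truncated subtraction harmless.
  have hcard : R.1.card + 1 = R.1.card - 1 + 2 := by
    have := hR.card_pos
    omega
  rw [hcard, pow_add, neg_one_sq, mul_one, zsmul_eq_mul]
  push_cast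
  congr 1
  refine Finset.sum_congr ?_ fun _ _ => rfl
  ext σ
  simp only [Finset.mem_inf', D, Finset.mem_filter, Finset.mem_univ, true_and, meet,
    Finset.le_inf_iff, id_eq]
  exact ⟨fun h => ⟨(h _ hR.choose_spec).1, fun ρ hρ => (h ρ hρ).2⟩,
    fun h ρ hρ => ⟨h.1, h.2 ρ hρ⟩⟩

end Pairwise

/-! ### The twelve partition sets are given by conditions on pairs of blocks -/

section Twelve

theorem isPairwise_setA : IsPairwise setA :=
  ⟨fun _ _ _ _ => True, by simp [setA], by simp, by simp⟩

theorem isPairwise_setI : IsPairwise setI := by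
  refine ⟨fun n f β γ => ∀ l ∈ β, ∀ i ∈ γ, ∀ j ∈ γ, ¬ (i < l ∧ l < j), ?_, ?_, ?_⟩
  · intro n f π
    constructor
    · exact fun h β hβ γ hγ hne l hl i hi j hj hlt => h l ⟨γ, hγ, fun hl' =>
        hne (Finpartition.eq_of_mem_parts _ hβ hγ hl hl'), i, hi, j, hj, hlt⟩
    · rintro h l ⟨γ, hγ, hl, i, hi, j, hj, hlt⟩
      obtain ⟨β, hβ, hlβ⟩ := π.exists_mem (Finset.mem_univ l)
      exact h β hβ γ hγ (fun e => hl (e ▸ hlβ)) l hlβ i hi j hj hlt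
  · exact fun n f β β' γ γ' hβ hγ h l hl i hi j hj => h l (hβ hl) i (hγ hi) j (hγ hj)
  · simp

/-- No two legs of `β` and two legs of `γ` cross. -/
def NoncrossingPair {n : ℕ} (β γ : Finset (Fin n)) : Prop :=
  ∀ i ∈ β, ∀ k ∈ β, ∀ j ∈ γ, ∀ l ∈ γ, ¬ (i < j ∧ j < k ∧ k < l)

theorem isNoncrossing_iff {n : ℕ} (π : LegPartition n) :
    IsNoncrossing π ↔ ∀ β ∈ π.parts, ∀ γ ∈ π.parts, β ≠ γ → NoncrossingPair β γ := by
  constructor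
  · exact fun h β hβ γ hγ hne i hi k hk j hj l hl hlt =>
      hne (h β hβ γ hγ i j k l hlt.1 hlt.2.1 hlt.2.2 hi hk hj hl)
  · intro h β hβ γ hγ i j k l hij hjk hkl hi hk hj hl
    by_contra hne
    exact h β hβ γ hγ hne i hi k hk j hj l hl ⟨hij, hjk, hkl⟩

theorem NoncrossingPair.mono {n : ℕ} {β β' γ γ' : Finset (Fin n)} (hβ : β' ⊆ β) (hγ : γ' ⊆ γ)
    (h : NoncrossingPair β γ) : NoncrossingPair β' γ' :=
  fun i hi k hk j hj l hl => h i (hβ hi) k (hβ hk) j (hγ hj) l (hγ hl)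

theorem noncrossingPair_map {m n : ℕ} (v : Fin m ↪o Fin n) (β γ : Finset (Fin m)) :
    NoncrossingPair (β.map v.toEmbedding) (γ.map v.toEmbedding) ↔ NoncrossingPair β γ := by
  simp [NoncrossingPair]

theorem isPairwise_setNC : IsPairwise setNC :=
  ⟨fun _ _ => NoncrossingPair, fun _ _ π => isNoncrossing_iff π,
    fun _ _ _ _ _ _ hβ hγ h => h.mono hβ hγ, fun _ _ v _ β γ => (noncrossingPair_map v β γ).symm⟩

theorem isPairwise_setBiNC : IsPairwise setBiNC := by
  refine ⟨fun n f β γ =>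
    (∀ i ∈ β, ∀ k ∈ β, ∀ j ∈ γ, ∀ l ∈ γ, i < j → j < k → k < l → f j ≠ f k) ∧
    ∀ i ∈ β, ∀ l ∈ β, ∀ j ∈ γ, ∀ k ∈ γ, i < j → j < k → k < l → f j = f k, ?_, ?_, ?_⟩
  · intro n f π
    constructor
    · intro h β hβ γ hγ hne
      exact ⟨fun i hi k hk j hj l hl h1 h2 h3 =>
          (h β hβ γ hγ hne i j k l h1 h2 h3).1 hi hk hj hl,
        fun i hi l hl j hj k hk h1 h2 h3 =>
          (h β hβ γ hγ hne i j k l h1 h2 h3).2 hi hl hj hk⟩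
    · intro h β hβ γ hγ hne i j k l h1 h2 h3
      exact ⟨fun hi hk hj hl => (h β hβ γ hγ hne).1 i hi k hk j hj l hl h1 h2 h3,
        fun hi hl hj hk => (h β hβ γ hγ hne).2 i hi l hl j hj k hk h1 h2 h3⟩
  · exact fun n f β β' γ γ' hβ hγ h =>
      ⟨fun i hi k hk j hj l hl => h.1 i (hβ hi) k (hβ hk) j (hγ hj) l (hγ hl),
        fun i hi l hl j hj k hk => h.2 i (hβ hi) l (hβ hl) j (hγ hj) k (hγ hk)⟩
  · simp

/-- The legs of `β` of colour `c` are outer with respect to `γ`. -/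
def OuterPair {n : ℕ} (c : Color) (f : Fin n → Color) (β γ : Finset (Fin n)) : Prop :=
  ∀ l ∈ β, f l = c → ∀ i ∈ γ, ∀ j ∈ γ, ¬ (i < l ∧ l < j)

theorem outer_iff {n : ℕ} (c : Color) (f : Fin n → Color) (π : LegPartition n) :
    (∀ l, f l = c → ¬ IsInner π l) ↔
      ∀ β ∈ π.parts, ∀ γ ∈ π.parts, β ≠ γ → OuterPair c f β γ := by
  constructor
  · exact fun h β hβ γ hγ hne l hl hc i hi j hj hlt => h l hc ⟨γ, hγ, fun hl' =>
      hne (Finpartition.eq_of_mem_parts _ hβ hγ hl hl'), i, hi, j, hj, hlt⟩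
  · rintro h l hc ⟨γ, hγ, hl, i, hi, j, hj, hlt⟩
    obtain ⟨β, hβ, hlβ⟩ := π.exists_mem (Finset.mem_univ l)
    exact h β hβ γ hγ (fun e => hl (e ▸ hlβ)) l hlβ hc i hi j hj hlt

theorem OuterPair.mono {n : ℕ} {c : Color} {f : Fin n → Color} {β β' γ γ' : Finset (Fin n)}
    (hβ : β' ⊆ β) (hγ : γ' ⊆ γ) (h : OuterPair c f β γ) : OuterPair c f β' γ' :=
  fun l hl hc i hi j hj => h l (hβ hl) hc i (hγ hi) j (hγ hj)

theorem outerPair_map {m n : ℕ} (c : Color) (v : Fin m ↪o Fin n) (f : Fin n → Color)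
    (β γ : Finset (Fin m)) :
    OuterPair c f (β.map v.toEmbedding) (γ.map v.toEmbedding) ↔ OuterPair c (f ∘ v) β γ := by
  simp [OuterPair]

theorem isPairwise_setIA (c : Color) : IsPairwise (setIA c) :=
  ⟨fun _ => OuterPair c, fun _ f π => outer_iff c f π,
    fun _ _ _ _ _ _ hβ hγ h => h.mono hβ hγ, fun _ _ v f β γ => (outerPair_map c v f β γ).symm⟩

theorem isPairwise_setINC (c : Color) : IsPairwise (setINC c) := by
  refine ⟨fun _ f β γ => NoncrossingPair β γ ∧ OuterPair c f β γ, ?_,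
    fun _ _ _ _ _ _ hβ hγ h => ⟨h.1.mono hβ hγ, h.2.mono hβ hγ⟩,
    fun _ _ v f β γ => ((noncrossingPair_map v β γ).and (outerPair_map c v f β γ)).symm⟩
  intro n f π
  refine ((isNoncrossing_iff π).and (outer_iff c f π)).trans ?_
  exact ⟨fun h β hβ γ hγ hne => ⟨h.1 β hβ γ hγ hne, h.2 β hβ γ hγ hne⟩,
    fun h => ⟨fun β hβ γ hγ hne => (h β hβ γ hγ hne).1,
      fun β hβ γ hγ hne => (h β hβ γ hγ hne).2⟩⟩

theorem isPairwise_setNCA (c : Color) : IsPairwise (setNCA c) := by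
  refine ⟨fun n f β γ => ∀ j ∈ β, ∀ k ∈ β, ∀ i ∈ γ, ∀ l ∈ γ, i < k → k < l → f k = c →
    i < j ∧ j < l ∧ f j = c, ?_, ?_, ?_⟩
  · intro n f π
    exact ⟨fun h β hβ γ hγ hne j hj k hk i hi l hl => h β hβ γ hγ hne i j k l hj hk hi hl,
      fun h β hβ γ hγ hne i j k l hj hk hi hl => h β hβ γ hγ hne j hj k hk i hi l hl⟩
  · exact fun n f β β' γ γ' hβ hγ h j hj k hk i hi l hl =>
      h j (hβ hj) k (hβ hk) i (hγ hi) l (hγ hl)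
  · simp

/-- Being monochrome concerns a single block, but it is required only if some other block surrounds
one of its legs, so it can be charged to that pair. -/
theorem isPairwise_setPNC : IsPairwise setPNC := by
  refine ⟨fun n f β γ => NoncrossingPair β γ ∧ ∀ l ∈ β, ∀ i ∈ γ, ∀ j ∈ γ, i < l → l < j →
    ∀ x ∈ β, ∀ y ∈ β, f x = f y, ?_, ?_, ?_⟩
  · intro n f π
    refine (and_congr_left' (isNoncrossing_iff π)).trans ?_
    constructor
    · intro h β hβ γ hγ hne
      exact ⟨h.1 β hβ γ hγ hne, fun l hl i hi j hj hil hlj => h.2 β hβ ⟨l, hl, γ, hγ,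
        fun hl' => hne (Finpartition.eq_of_mem_parts _ hβ hγ hl hl'), i, hi, j, hj, hil, hlj⟩⟩
    · refine fun h => ⟨fun β hβ γ hγ hne => (h β hβ γ hγ hne).1, ?_⟩
      rintro β hβ ⟨l, hl, γ, hγ, hlγ, i, hi, j, hj, hil, hlj⟩
      exact (h β hβ γ hγ fun e => hlγ (e ▸ hl)).2 l hl i hi j hj hil hlj
  · exact fun n f β β' γ γ' hβ hγ h => ⟨h.1.mono hβ hγ, fun l hl i hi j hj hil hlj x hx y hy =>
      h.2 l (hβ hl) i (hγ hi) j (hγ hj) hil hlj x (hβ hx) y (hβ hy)⟩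
  · intro m n v f β γ
    beta_reduce
    rw [noncrossingPair_map]
    simp

theorem isInnerPair_map {m n : ℕ} (v : Fin m ↪o Fin n) (β γ : Finset (Fin m)) (x : Fin n) :
    IsInnerPair (β.map v.toEmbedding) (γ.map v.toEmbedding) x ↔
      ∃ l, IsInnerPair β γ l ∧ v l = x := by
  constructor
  · rintro (⟨hx, i, hi, j, hj, h1, h2⟩ | ⟨hx, i, hi, j, hj, h1, h2⟩)
    all_goals
      obtain ⟨l, hl, rfl⟩ := Finset.mem_map.1 hx
      obtain ⟨i, hi', rfl⟩ := Finset.mem_map.1 hi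
      obtain ⟨j, hj', rfl⟩ := Finset.mem_map.1 hj
    · exact ⟨l, Or.inl ⟨hl, i, hi', j, hj', v.lt_iff_lt.1 h1, v.lt_iff_lt.1 h2⟩, rfl⟩
    · exact ⟨l, Or.inr ⟨hl, i, hi', j, hj', v.lt_iff_lt.1 h1, v.lt_iff_lt.1 h2⟩, rfl⟩
  · rintro ⟨l, ⟨hl, i, hi, j, hj, h1, h2⟩ | ⟨hl, i, hi, j, hj, h1, h2⟩, rfl⟩
    · exact Or.inl ⟨Finset.mem_map_of_mem _ hl, v i, Finset.mem_map_of_mem _ hi, v j,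
        Finset.mem_map_of_mem _ hj, v.lt_iff_lt.2 h1, v.lt_iff_lt.2 h2⟩
    · exact Or.inr ⟨Finset.mem_map_of_mem _ hl, v i, Finset.mem_map_of_mem _ hi, v j,
        Finset.mem_map_of_mem _ hj, v.lt_iff_lt.2 h1, v.lt_iff_lt.2 h2⟩

theorem IsInnerPair.mono {n : ℕ} {β β' γ γ' : Finset (Fin n)} (hβ : β' ⊆ β) (hγ : γ' ⊆ γ)
    {l : Fin n} (h : IsInnerPair β' γ' l) : IsInnerPair β γ l := by
  rcases h with ⟨hl, i, hi, j, hj, h⟩ | ⟨hl, i, hi, j, hj, h⟩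
  · exact Or.inl ⟨hβ hl, i, hγ hi, j, hγ hj, h⟩
  · exact Or.inr ⟨hγ hl, i, hβ hi, j, hβ hj, h⟩

theorem isPairwise_setPC : IsPairwise setPC := by
  refine ⟨fun n f β γ => ∀ l l', IsInnerPair β γ l → IsInnerPair β γ l' → f l = f l',
    fun n f π => Iff.rfl, fun n f β β' γ γ' hβ hγ h l l' hl hl' =>
      h l l' (hl.mono hβ hγ) (hl'.mono hβ hγ), fun m n v f β γ => ⟨fun h l l' hl hl' => ?_,
        fun h l l' hl hl' => h _ _ ((isInnerPair_map v β γ _).2 ⟨l, hl, rfl⟩)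
          ((isInnerPair_map v β γ _).2 ⟨l', hl', rfl⟩)⟩⟩
  obtain ⟨x, hx, rfl⟩ := (isInnerPair_map v β γ _).1 hl
  obtain ⟨y, hy, rfl⟩ := (isInnerPair_map v β γ _).1 hl'
  exact h x y hx hy

theorem isPairwise_of_mem_twelveSets {Pi : PartitionSet Color} (h : Pi ∈ twelveSets) :
    IsPairwise Pi := by
  rcases h with rfl | rfl | rfl | rfl | rfl | rfl | rfl | rfl | rfl | rfl | rfl | rfl
  · exact isPairwise_setI
  · exact isPairwise_setNC
  · exact isPairwise_setBiNC
  · exact isPairwise_setINC _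
  · exact isPairwise_setINC _
  · exact isPairwise_setIA _
  · exact isPairwise_setIA _
  · exact isPairwise_setNCA _
  · exact isPairwise_setNCA _
  · exact isPairwise_setPNC
  · exact isPairwise_setPC
  · exact isPairwise_setA

end Twelve

/-! ### Mixed moments -/

section Moments

variable {n : ℕ} {f : Fin n → F} {Pi : PartitionSet F}

theorem liftFunctional_prod {k : ℕ} (A : Fin (k + 1) → FacedAlg.{u} F)
    (Φ : (FacedAlg.iter A).Functional) (b : Fin n → Fin (k + 1))
    (a : ∀ i, (A (b i)).face (f i)) {w : List (Fin n)} (hw : w ≠ []) :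
    liftFunctional A Φ ((w.map fun i => faceTensor A (b i) (f i) (a i)).prod) =
      Φ (nprod (w.map fun i => FacedAlg.incl A (b i) (a i : A (b i)))) := by
  have e : multiplication A ((w.map fun i => faceTensor A (b i) (f i) (a i)).prod) =
      ((nprod (w.map fun i => FacedAlg.incl A (b i) (a i : A (b i))) : FacedAlg.iter A) :
        Unitization ℂ (FacedAlg.iter A)) := by
    rw [inr_nprod (by simpa using hw), map_list_prod, List.map_map, List.map_map]
    congr 2
    funext i
    simp [faceTensor, multiplication, DirectSum.toModule_lof]
    rfl
  rw [liftFunctional, LinearMap.comp_apply, LinearMap.comp_apply, AlgHom.toLinearMap_apply, e]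
  rfl

theorem IsPairwise.isNormalized (h : IsPairwise Pi) :
    IsNormalized fun n f π => if π ∈ Pi n f then (1 : ℂ) else 0 :=
  fun _ _ _ hπ => if_pos (h.mem_of_univ_mem hπ)

theorem map_sort_blockEmb (β : Finset (Fin n)) (δ : Finset (Fin β.card)) :
    (δ.sort (· ≤ ·)).map (blockEmb β) =
      (δ.map (blockEmb β).toEmbedding).sort (· ≤ ·) :=
  Finset.map_sort (blockEmb β).toEmbedding δ _ _ fun _ _ _ _ => (blockEmb β).le_iff_le.symm

/-- A family of moments with cumulants supported on monochromatic words satisfies the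
inclusion-exclusion formula. -/
theorem IsPairwise.moment_eq (h : IsPairwise Pi) {S : Type*} (b : Fin n → S) (hn : n ≠ 0)
    {M C : List (Fin n) → ℂ} (hC : ∀ w, C w ≠ 0 → ∃ κ, ∀ i ∈ w, b i = κ)
    (hM : ∀ (m : ℕ) (v : Fin m → Fin n), m ≠ 0 → Function.Injective v →
      M ((List.finRange m).map v) = ∑ σ : LegPartition m,
        (if σ ∈ Pi m (f ∘ v) then (1 : ℂ) else 0) * ∏ β ∈ σ.parts, C ((β.sort (· ≤ ·)).map v)) :
    M (List.finRange n) =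
      ∑ R ∈ (coarsestRefinements Pi f (kerPartition b)).powerset.filter Finset.Nonempty,
        (-1 : ℂ) ^ (R.card - 1) * ∏ β ∈ (meet R).parts, M (β.sort (· ≤ ·)) := by
  -- Moments of blocks obey the same moment-cumulant formula, with the legs of `β` enumerated
  -- increasingly.
  have hblock : ∀ β : Finset (Fin n), β.Nonempty → M (β.sort (· ≤ ·)) =
      ∑ τ ∈ Finset.univ.filter (fun τ => τ ∈ Pi β.card (f ∘ blockEmb β)),
        ∏ δ ∈ τ.parts, C ((δ.map (blockEmb β).toEmbedding).sort (· ≤ ·)) := by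
    intro β hβ
    have e : (List.finRange β.card).map (blockEmb β) = β.sort (· ≤ ·) :=
      Finset.listMap_orderEmbOfFin_finRange β rfl
    rw [← e, hM _ _ hβ.card_pos.ne' (blockEmb β).injective, Finset.sum_filter]
    refine Finset.sum_congr rfl fun τ _ => ?_
    rw [ite_mul, one_mul, zero_mul]
    simp only [map_sort_blockEmb]
  have htop : M (List.finRange n) =
      ∑ σ ∈ Finset.univ.filter (fun σ => σ ∈ Pi n f ∧ σ ≤ kerPartition b),
        ∏ β ∈ σ.parts, C (β.sort (· ≤ ·)) := by
    have e := hM n id hn Function.injective_id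
    rw [List.map_id] at e
    rw [e, Finset.sum_filter]
    refine Finset.sum_congr rfl fun σ _ => ?_
    simp only [List.map_id, Function.comp_id]
    by_cases hσ : σ ∈ Pi n f
    · by_cases hle : σ ≤ kerPartition b
      · rw [if_pos hσ, if_pos ⟨hσ, hle⟩, one_mul]
      · rw [if_neg (c := σ ∈ Pi n f ∧ σ ≤ kerPartition b) fun h => hle h.2, if_pos hσ, one_mul]
        by_contra hne
        -- A nonzero product forces every block of `σ` to carry a single label, hence `σ ≤
        -- kerPartition b`.
        refine hle fun β hβ => ?_
        obtain ⟨κ, hκ⟩ := hC _ (Finset.prod_ne_zero_iff.1 hne β hβ)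
        obtain ⟨i, hi⟩ := Finpartition.nonempty_of_mem_parts _ hβ
        have hb : ∀ i' ∈ β, b i' = b i := fun i' hi' =>
          (hκ i' ((Finset.mem_sort _).2 hi')).trans (hκ i ((Finset.mem_sort _).2 hi)).symm
        exact ⟨Finset.univ.filter fun i' => b i' = b i,
          mem_kerPartition_parts.2 ⟨i, fun i' => by simp⟩,
          fun i' hi' => Finset.mem_filter.2 ⟨Finset.mem_univ _, hb i' hi'⟩⟩
    · rw [if_neg hσ, if_neg (c := σ ∈ Pi n f ∧ σ ≤ kerPartition b) fun h => hσ h.1, zero_mul]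
  rw [htop, sum_refinements_eq]
  refine Finset.sum_congr rfl fun R hR => ?_
  have hmem : meet R ∈ Pi n f := h.meet_mem fun σ hσ =>
    (Finset.mem_filter.1 (Finset.mem_powerset.1 (Finset.mem_filter.1 hR).1 hσ)).2.prop.1
  rw [← h.prod_sum_blocks hmem fun β => C (β.sort (· ≤ ·))]
  congr 1
  exact Finset.prod_congr rfl fun β hβ =>
    (hblock β (Finpartition.nonempty_of_mem_parts _ hβ)).symm

/-- Evaluating a word of the free algebra on the generators `1, …, n` at the elements `a i` reduces
the statement to `IsPairwise.moment_eq` for a convolution. -/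
theorem UniversalProduct.IsCombinatorial.iter_eq {P : UniversalProduct.{u} F}
    (hP : P.IsCombinatorial Pi) (hPi : IsPairwise Pi) {k : ℕ} (hn : n ≠ 0)
    (A : Fin (k + 1) → FacedAlg.{u} F) (φ : ∀ κ, (A κ).Functional)
    (b : Fin n → Fin (k + 1)) (a : ∀ i, (A (b i)).face (f i)) :
    P.iter A φ (nprod (List.ofFn fun i => FacedAlg.incl A (b i) (a i : A (b i)))) =
      ∑ R ∈ (coarsestRefinements Pi f (kerPartition b)).powerset.filter Finset.Nonempty,
        (-1 : ℂ) ^ (R.card - 1) *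
          tensorPowerEval (liftFunctional A (P.iter A φ)) (meet R)
            (fun i => faceTensor A (b i) (f i) (a i)) := by
  have : Fact P.IsSymmetric := ⟨hP.1⟩
  -- Each leg is sent to its element in the factor of its own label and to zero elsewhere, so the
  -- sum over the factors is that element, and the functional with index `κ` vanishes on words
  -- containing a leg of another label.
  let e : ∀ κ, Fin n → A κ := fun κ i =>
    if h : b i = κ then h ▸ (a i : A (b i)) else 0
  have he : ∀ i, e (b i) i = a i := fun i => dif_pos rfl
  have he0 : ∀ κ i, b i ≠ κ → e κ i = 0 := fun κ i h => dif_neg h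
  have hface : ∀ κ i, e κ i ∈ (A κ).face (f i) := by
    intro κ i
    by_cases h : b i = κ
    · subst h
      rw [he]
      exact (a i).2
    · rw [he0 κ i h]
      exact zero_mem _
  have hsum : (fun i => ∑ κ, FacedAlg.incl A κ (e κ i)) =
      fun i => FacedAlg.incl A (b i) (a i : A (b i)) := by
    funext i
    rw [Finset.sum_eq_single (b i), he]
    · intro κ _ hκ
      rw [he0 κ i hκ.symm, map_zero]
    · exact fun h => absurd (Finset.mem_univ _) h
  have hprod := convProd_pull_lift P φ hface
  rw [hsum] at hprod
  have hword : ∀ w : List (Fin n),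
      convProd P Finset.univ (fun κ => pull (φ κ) (lift f (e κ))) (word f w) =
        P.iter A φ (nprod (w.map fun i => FacedAlg.incl A (b i) (a i : A (b i)))) := by
    intro w
    rw [hprod, pull_apply, lift_word]
  have hmask : ∀ κ, ∀ v : List (Fin n), (∃ i ∈ v, b i ≠ κ) →
      pull (φ κ) (lift f (e κ)) (word f v) = 0 := by
    rintro κ v ⟨i, hi, hκ⟩
    rw [pull_apply, lift_word, nprod_eq_zero (List.mem_map.2 ⟨i, hi, he0 κ i hκ⟩), map_zero]
  obtain ⟨C, hC, hM⟩ := exists_moment_cumulant P hPi.isNormalized hP.2 hmask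
  have main := hPi.moment_eq (f := f) b hn (M := fun w =>
    convProd P Finset.univ (fun κ => pull (φ κ) (lift f (e κ))) (word f w)) hC hM
  beta_reduce at main
  rw [hword, ← List.ofFn_eq_map] at main
  rw [main]
  refine Finset.sum_congr rfl fun R _ => ?_
  congr 1
  refine Finset.prod_congr rfl fun β hβ => ?_
  obtain ⟨i, hi⟩ := Finpartition.nonempty_of_mem_parts _ hβ
  rw [hword, liftFunctional_prod A (P.iter A φ) b a
    (List.ne_nil_of_mem ((Finset.mem_sort (· ≤ ·)).2 hi))]

end Moments

end MultiFaced

end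

theorem theorem8p4 (P : MultiFaced.UniversalProduct.{u} MultiFaced.Color)
    (Pi : MultiFaced.PartitionSet MultiFaced.Color) (hPi : Pi ∈ MultiFaced.twelveSets)
    (hP : P.IsCombinatorial Pi)
    (k n : ℕ) (hn : 0 < n)
    (A : Fin (k + 1) → MultiFaced.FacedAlg.{u} MultiFaced.Color)
    (φ : ∀ κ, (A κ).Functional)
    (b : Fin n → Fin (k + 1)) (f : Fin n → MultiFaced.Color)
    (a : ∀ i, (A (b i)).face (f i)) :
    P.iter A φ (MultiFaced.nprod (List.ofFn fun i => MultiFaced.FacedAlg.incl A (b i) (a i : A (b i)))) =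
      ∑ R ∈ (MultiFaced.coarsestRefinements Pi f
          (MultiFaced.blockPartition b)).powerset.filter Finset.Nonempty,
        (-1 : ℂ) ^ (R.card - 1) *
          MultiFaced.tensorPowerEval (MultiFaced.liftFunctional A (P.iter A φ))
            (MultiFaced.meet R) (fun i => MultiFaced.faceTensor A (b i) (f i) (a i)) := by
  -- `blockPartition b` and `kerPartition b` agree by definition.
  exact hP.iter_eq (MultiFaced.isPairwise_of_mem_twelveSets hPi) hn.ne' A φ b a
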